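/- Let $(\Omega,\mathcal F,\mathsf P)$ be a probability space and let $\mathsf L_0$ be the space of (equivalence classes of) real random variables with convergence in probability. A stochastic measure $\mu$ on the Borel $\sigma$-algebra of $[0,T]$ is a map from the Borel subsets of $[0,T]$ to $\mathsf L_0$ that is $\sigma$-additive in probability. A measurable function $g:[0,T]\to\mathbb R$ is integrable with respect to $\mu$ if there are simple functions $g_n\to g$ pointwise such that $\int_A g_n\,d\mu$ converges in probability for every Borel set $A\subseteq[0,T]$, where $\int_A f\,d\mu=\sum_y y\,\mu(A\cap\{f=y\})$ for simple $f$. Assume that there is a finite measure $\mathsf m$ on the Borel subsets of $[0,T]$ such that every measurable $h:[0,T]\to\mathbb R$ with $\int h^2\,d\mathsf m<\infty$ is integrable with respect to $\mu$, and that the process $\mu_t=\mu((0,t])$, $0\le t\le T$, has (a version with almost surely) continuous paths, which we denote again by $\mu_t$. Let $0<T_1<T$. Then for every $\delta>0$ $$\frac1\varepsilon\int_{[0,T_1]}|\mu_{s+\varepsilon}-\mu_s|^{2+\delta}\,ds\to 0\quad\text{in probability as }\varepsilon\to0+ .$$ In particular, $\mu_t$ has strong cubic variation $[\mu;3](t)=0$,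 $0\le t\le T_1$, on $[0,T_1]$; that is, $$\sup_{0\le t\le T_1}\Bigl|\frac1\varepsilon\int_{[0,t]}(\mu_{s+\varepsilon}-\mu_s)^3\,ds\Bigr|\to0\quad\text{in probability as }\varepsilon\to0+,$$ and every sequence $\varepsilon_i\to0+$ has a subsequence $\tilde\varepsilon_i$ such that $$\sup_i\frac1{\tilde\varepsilon_i}\int_{[0,T_1]}|\mu_{s+\tilde\varepsilon_i}-\mu_s|^3\,ds<\infty\quad\text{almost surely.}$$ -/

import Mathlib

open MeasureTheory Filter Topology

/-- A (general) stochastic measure: a map from measurable subsets of `𝓧` to `L₀(Ω, 𝓕, P)` (the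
a.e. equivalence classes of real random variables) that is `σ`-additive in probability.
The values on non-measurable sets play no role. -/
structure StochasticMeasure (𝓧 : Type*) [MeasurableSpace 𝓧] {Ω : Type*} [MeasurableSpace Ω]
    (P : Measure Ω) where
  /-- the set function -/
  val : Set 𝓧 → (Ω →ₘ[P] ℝ)
  /-- countable additivity, the series converging in probability -/
  sigma_additive : ∀ A : ℕ → Set 𝓧, (∀ i, MeasurableSet (A i)) →
    Pairwise (fun i j => Disjoint (A i) (A j)) →
    TendstoInMeasure P (fun n ω => ∑ i ∈ Finset.range n, val (A i) ω) atTop (val (⋃ i, A i))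

namespace StochasticMeasure

variable {𝓧 : Type*} [MeasurableSpace 𝓧] {Ω : Type*} [MeasurableSpace Ω] {P : Measure Ω}

/-- The integral `∫_A f dμ = ∑ y, y μ(A ∩ {f = y})` of a simple function. -/
noncomputable def simpleIntegral (μ : StochasticMeasure 𝓧 P) (f : SimpleFunc 𝓧 ℝ) (A : Set 𝓧) :
    Ω →ₘ[P] ℝ :=
  ∑ y ∈ f.range, y • μ.val (A ∩ f ⁻¹' {y})

/-- A deterministic function `g` is integrable with respect to `μ` on `𝓧`: there are simple
functions `f n → g` such that `∫_A f n dμ` converges in probability for every measurable `A`.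
The limit, for `A = 𝓧`, is the integral of `g`. -/
def IsIntegrable (μ : StochasticMeasure 𝓧 P) (g : 𝓧 → ℝ) : Prop :=
  ∃ f : ℕ → SimpleFunc 𝓧 ℝ,
    (∀ x, Tendsto (fun n => f n x) atTop (𝓝 (g x))) ∧
    ∀ A : Set 𝓧, MeasurableSet A →
      ∃ ξ : Ω →ₘ[P] ℝ, TendstoInMeasure P (fun n => ⇑(μ.simpleIntegral (f n) A)) atTop ξ

/-- There is a finite (nonnegative) measure `m` on `𝓧` such that every measurable `h` with
`∫ h² dm < ∞` is integrable with respect to `μ`. -/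
def SquareIntegrableDominated (μ : StochasticMeasure 𝓧 P) : Prop :=
  ∃ m : Measure 𝓧, IsFiniteMeasure m ∧
    ∀ h : 𝓧 → ℝ, Measurable h → ∫⁻ x, ENNReal.ofReal (h x ^ 2) ∂m < ⊤ → μ.IsIntegrable h

end StochasticMeasure

/-- `V` is the strong `n`-variation `[X; n]` on `[0, T₁]` of the process `X`, which is
continuous on some `[0, T]` with `T₁ < T` (only the values of `X` on `[0, T]` matter, since `ε`
may be taken less than `T - T₁`):
* `ε⁻¹ ∫_{[0,t]} (X_{s+ε} - X_s)ⁿ ds → V_t` in probability as `ε → 0+`, uniformly in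
  `t ∈ [0, T₁]`;
* every sequence `e i → 0+` has a subsequence along which
  `ε⁻¹ ∫_{[0,T₁]} |X_{s+ε} - X_s|ⁿ ds` is almost surely bounded. -/
def HasStrongVariation {Ω : Type*} [MeasurableSpace Ω] (P : Measure Ω) (X : ℝ → Ω → ℝ) (n : ℕ)
    (T₁ : ℝ) (V : ℝ → Ω → ℝ) : Prop :=
  (∀ η : ℝ, 0 < η → Tendsto
    (fun ε : ℝ => P {ω | ENNReal.ofReal η ≤ ⨆ t ∈ Set.Icc 0 T₁,
      ENNReal.ofReal |1 / ε * (∫ s in Set.Icc 0 t, (X (s + ε) ω - X s ω) ^ n) - V t ω|})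
    (𝓝[>] 0) (𝓝 0)) ∧
  ∀ e : ℕ → ℝ, (∀ i, 0 < e i) → Tendsto e atTop (𝓝 0) →
    ∃ φ : ℕ → ℕ, StrictMono φ ∧ ∀ᵐ ω ∂P, BddAbove (Set.range fun i =>
      1 / e (φ i) * ∫ s in Set.Icc 0 T₁, |X (s + e (φ i)) ω - X s ω| ^ n)

/-! The heart of the matter is that `h⁻¹ ∫ (X (s + h) - X s)² ds` stays bounded in probability as `h
→ 0+`. Since `|y| ^ (2 + δ) ≤ ρ ^ δ * y²` for `|y| ≤ ρ`, uniform continuity of the paths, which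
makes `ρ` small, gives the limit `0`; the cubic statements are the case `δ = 1`.

With mesh `Δ = h / n`, the Riemann sums of that quotient are `n⁻¹ ∑ⱼ μ((jΔ, (j+n)Δ])² = ∑ⱼ (T fⱼ)²`.
Here `T` integrates step functions against `μ`, and `fⱼ = n^(-1/2) 1_(jΔ, (j+n)Δ]`. Each point lies
in at most `n` of these intervals, so `∑ fⱼ² ≤ 1`. It remains to bound square functions in
probability, uniformly in the partition. Two facts do this.

Boundedness of the range (`IsExhaustiveCharge.bounded`): the values of `μ` form a set bounded in
probability. Otherwise random unions of cells of fine partitions produce disjoint sets on which `μ`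
does not tend to `0`.

Square functions (`exists_square_function_bound`): a bound on all subset sums passes to coefficients
in `[-1, 1]` by a Paley–Zygmund argument. A Nikishin-type exhaustion makes `T` of weak type `(1, 1)`
off a small event. Random signs then linearise the square function: `∑ ± fⱼ` is truncated, the
bounded part is handled by the weak type estimate, and the tail is again a square function, at a
doubled level. Iteration sums a geometric series. -/

/-! ### Random subsets of a finite set: moments, Paley–Zygmund and concentration. -/

section RandomSubset

variable {ι : Type*} [DecidableEq ι]

/-- The probability that the random subset of `s` which contains every `i ∈ s` independently with
probability `p i` equals `S`. -/
noncomputable def subsetWeight (s : Finset ι) (p : ι → ℝ) (S : Finset ι) : ℝ :=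
  (∏ i ∈ S, p i) * ∏ i ∈ s \ S, (1 - p i)

/-- The expectation of `g S` for the random subset `S` of `s` which contains every `i ∈ s`
independently with probability `p i`. -/
noncomputable def subsetExp (s : Finset ι) (p : ι → ℝ) (g : Finset ι → ℝ) : ℝ :=
  ∑ S ∈ s.powerset, subsetWeight s p S * g S

theorem subsetExp_congr {s : Finset ι} {p : ι → ℝ} {g g' : Finset ι → ℝ}
    (h : ∀ S ⊆ s, g S = g' S) : subsetExp s p g = subsetExp s p g' :=
  Finset.sum_congr rfl fun S hS => by rw [h S (Finset.mem_powerset.1 hS)]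

theorem subsetExp_insert {s : Finset ι} {a : ι} (ha : a ∉ s) (p : ι → ℝ) (g : Finset ι → ℝ) :
    subsetExp (insert a s) p g =
      p a * subsetExp s p (fun S => g (insert a S)) + (1 - p a) * subsetExp s p g := by
  unfold subsetExp subsetWeight
  rw [Finset.sum_powerset_insert ha, Finset.mul_sum, Finset.mul_sum, add_comm]
  congr 1
  · refine Finset.sum_congr rfl fun S hS => ?_
    have haS : a ∉ S := fun h => ha (Finset.mem_powerset.1 hS h)
    rw [Finset.prod_insert haS]
    have : insert a s \ insert a S = s \ S := by
      ext i; by_cases hi : i = a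
      · subst hi; simp [ha]
      · simp [hi]
    rw [this]; ring
  · refine Finset.sum_congr rfl fun S hS => ?_
    have haS : a ∉ S := fun h => ha (Finset.mem_powerset.1 hS h)
    rw [Finset.insert_sdiff_of_notMem _ haS,
      Finset.prod_insert (by simp [ha])]
    ring

theorem subsetExp_add (s : Finset ι) (p : ι → ℝ) (g g' : Finset ι → ℝ) :
    subsetExp s p (fun S => g S + g' S) = subsetExp s p g + subsetExp s p g' := by
  simp only [subsetExp, mul_add, Finset.sum_add_distrib]

theorem subsetExp_const_mul (s : Finset ι) (p : ι → ℝ) (c : ℝ) (g : Finset ι → ℝ) :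
    subsetExp s p (fun S => c * g S) = c * subsetExp s p g := by
  simp only [subsetExp, Finset.mul_sum, mul_left_comm]

theorem subsetExp_one (s : Finset ι) (p : ι → ℝ) : subsetExp s p (fun _ => 1) = 1 := by
  induction s using Finset.induction_on with
  | empty => simp [subsetExp, subsetWeight]
  | insert a s ha ih => rw [subsetExp_insert ha, ih]; ring

theorem subsetExp_const (s : Finset ι) (p : ι → ℝ) (c : ℝ) : subsetExp s p (fun _ => c) = c := by
  have := subsetExp_const_mul s p c (fun _ => 1)
  simpa [subsetExp_one] using this

theorem subsetWeight_nonneg {s : Finset ι} {p : ι → ℝ} (h0 : ∀ i, 0 ≤ p i) (h1 : ∀ i, p i ≤ 1)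
    (S : Finset ι) : 0 ≤ subsetWeight s p S :=
  mul_nonneg (Finset.prod_nonneg fun i _ => h0 i)
    (Finset.prod_nonneg fun i _ => sub_nonneg.2 (h1 i))

theorem subsetExp_mono {s : Finset ι} {p : ι → ℝ} (h0 : ∀ i, 0 ≤ p i) (h1 : ∀ i, p i ≤ 1)
    {g g' : Finset ι → ℝ} (h : ∀ S ⊆ s, g S ≤ g' S) : subsetExp s p g ≤ subsetExp s p g' :=
  Finset.sum_le_sum fun S hS =>
    mul_le_mul_of_nonneg_left (h S (Finset.mem_powerset.1 hS)) (subsetWeight_nonneg h0 h1 S)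

theorem exists_subsetExp_le {s : Finset ι} {p : ι → ℝ} (h0 : ∀ i, 0 ≤ p i) (h1 : ∀ i, p i ≤ 1)
    (g : Finset ι → ℝ) : ∃ S ⊆ s, subsetExp s p g ≤ g S := by
  obtain ⟨S, hS, hmax⟩ := Finset.exists_max_image s.powerset g ⟨∅, by simp⟩
  refine ⟨S, Finset.mem_powerset.1 hS, ?_⟩
  calc subsetExp s p g ≤ subsetExp s p (fun _ => g S) :=
        subsetExp_mono h0 h1 fun S' hS' => hmax S' (Finset.mem_powerset.2 hS')
    _ = g S := subsetExp_const s p _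

/-- The probability that a fixed element is selected. -/
theorem subsetExp_mem {s : Finset ι} (p : ι → ℝ) {i : ι} (hi : i ∈ s) :
    subsetExp s p (fun S => if i ∈ S then 1 else 0) = p i := by
  induction s using Finset.induction_on with
  | empty => simp at hi
  | insert a s ha ih =>
    rw [subsetExp_insert ha]
    by_cases hia : i = a
    · subst hia
      have : subsetExp s p (fun S => if i ∈ S then (1 : ℝ) else 0) = subsetExp s p (fun _ => 0) :=
        subsetExp_congr fun S hS => if_neg fun h => ha (hS h)
      rw [this, subsetExp_const]
      simp [subsetExp_one]
    · have his : i ∈ s := by simpa [hia] using hi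
      simp only [Finset.mem_insert, hia, false_or]
      rw [ih his]; ring

/-- The centred sum `∑ (1_{i ∈ S} - p i) x i`. -/
noncomputable def centredSum (s : Finset ι) (p x : ι → ℝ) (S : Finset ι) : ℝ :=
  ∑ i ∈ s, ((if i ∈ S then 1 else 0) - p i) * x i

theorem centredSum_insert_insert {s : Finset ι} {a : ι} (ha : a ∉ s) (p x : ι → ℝ)
    (S : Finset ι) :
    centredSum (insert a s) p x (insert a S) = (1 - p a) * x a + centredSum s p x S := by
  unfold centredSum
  rw [Finset.sum_insert ha]
  congr 1
  · simp
  · refine Finset.sum_congr rfl fun i hi => ?_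
    have : i ≠ a := fun h => ha (h ▸ hi)
    simp [this]

theorem centredSum_insert {s : Finset ι} {a : ι} (ha : a ∉ s) (p x : ι → ℝ)
    {S : Finset ι} (hS : S ⊆ s) :
    centredSum (insert a s) p x S = (- p a) * x a + centredSum s p x S := by
  unfold centredSum
  rw [Finset.sum_insert ha]
  have : a ∉ S := fun h => ha (hS h)
  simp [this]

theorem subsetExp_comp_centredSum_insert {s : Finset ι} {a : ι} (ha : a ∉ s) (p x : ι → ℝ)
    (G : ℝ → ℝ) :
    subsetExp (insert a s) p (fun S => G (centredSum (insert a s) p x S)) =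
      p a * subsetExp s p (fun S => G ((1 - p a) * x a + centredSum s p x S)) +
      (1 - p a) * subsetExp s p (fun S => G ((- p a) * x a + centredSum s p x S)) := by
  rw [subsetExp_insert ha]
  congr 2
  · exact subsetExp_congr fun S _ => by rw [centredSum_insert_insert ha]
  · exact subsetExp_congr fun S hS => by rw [centredSum_insert ha p x hS]

theorem subsetExp_centredSum (s : Finset ι) (p x : ι → ℝ) :
    subsetExp s p (centredSum s p x) = 0 := by
  induction s using Finset.induction_on with
  | empty => simp [subsetExp, centredSum]
  | insert a s ha ih =>
    have := subsetExp_comp_centredSum_insert ha p x id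
    simp only [id] at this
    rw [this, subsetExp_add, subsetExp_add, subsetExp_const, subsetExp_const, ih]
    ring

theorem subsetExp_add_centredSum_sq_aux (s : Finset ι) (p x : ι → ℝ) (c : ℝ) :
    subsetExp s p (fun S => (c + centredSum s p x S) ^ 2) =
      c ^ 2 + subsetExp s p (fun S => centredSum s p x S ^ 2) := by
  have : (fun S => (c + centredSum s p x S) ^ 2) =
      fun S => c ^ 2 + (2 * c * centredSum s p x S + centredSum s p x S ^ 2) := by
    funext S; ring
  rw [this, subsetExp_add, subsetExp_add, subsetExp_const, subsetExp_const_mul,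
    subsetExp_centredSum]
  ring

theorem subsetExp_centredSum_sq (s : Finset ι) (p x : ι → ℝ) :
    subsetExp s p (fun S => centredSum s p x S ^ 2) = ∑ i ∈ s, p i * (1 - p i) * x i ^ 2 := by
  induction s using Finset.induction_on with
  | empty => simp [subsetExp, centredSum]
  | insert a s ha ih =>
    rw [subsetExp_comp_centredSum_insert ha p x (fun y => y ^ 2),
      subsetExp_add_centredSum_sq_aux, subsetExp_add_centredSum_sq_aux, ih, Finset.sum_insert ha]
    ring

theorem subsetExp_add_centredSum_sq (s : Finset ι) (p x : ι → ℝ) (c : ℝ) :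
    subsetExp s p (fun S => (c + centredSum s p x S) ^ 2) =
      c ^ 2 + ∑ i ∈ s, p i * (1 - p i) * x i ^ 2 := by
  rw [subsetExp_add_centredSum_sq_aux, subsetExp_centredSum_sq]

theorem subsetExp_add_centredSum_pow_four (s : Finset ι) (p x : ι → ℝ) (c : ℝ) :
    subsetExp s p (fun S => (c + centredSum s p x S) ^ 4) =
      c ^ 4 + 6 * c ^ 2 * (∑ i ∈ s, p i * (1 - p i) * x i ^ 2)
        + 4 * c * subsetExp s p (fun S => centredSum s p x S ^ 3)
        + subsetExp s p (fun S => centredSum s p x S ^ 4) := by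
  have : (fun S => (c + centredSum s p x S) ^ 4) =
      fun S => c ^ 4 + (4 * c ^ 3 * centredSum s p x S + (6 * c ^ 2 * centredSum s p x S ^ 2 +
        (4 * c * centredSum s p x S ^ 3 + centredSum s p x S ^ 4))) := by
    funext S; ring
  rw [this, subsetExp_add, subsetExp_add, subsetExp_add, subsetExp_add, subsetExp_const,
    subsetExp_const_mul, subsetExp_const_mul, subsetExp_const_mul,
    subsetExp_centredSum, subsetExp_centredSum_sq]
  ring

/-- When one independent centred summand is added, the third-moment terms cancel and the mixed term
is `6 V * var ≤ 18 V * var`. The new fourth moment is at most `9 var²` because `p` stays away from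
`0` and `1`. -/
theorem subsetExp_centredSum_pow_four_le (s : Finset ι) {p : ι → ℝ} (h0 : ∀ i, 1 / 4 ≤ p i)
    (h1 : ∀ i, p i ≤ 3 / 4) (x : ι → ℝ) :
    subsetExp s p (fun S => centredSum s p x S ^ 4) ≤
      9 * (∑ i ∈ s, p i * (1 - p i) * x i ^ 2) ^ 2 := by
  induction s using Finset.induction_on with
  | empty => simp [subsetExp, centredSum]
  | insert a s ha ih =>
    rw [subsetExp_comp_centredSum_insert ha p x (fun y => y ^ 4),
      subsetExp_add_centredSum_pow_four, subsetExp_add_centredSum_pow_four, Finset.sum_insert ha]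
    set V := ∑ i ∈ s, p i * (1 - p i) * x i ^ 2
    set M3 := subsetExp s p (fun S => centredSum s p x S ^ 3)
    set M4 := subsetExp s p (fun S => centredSum s p x S ^ 4)
    have hp0 := h0 a
    have hp1 := h1 a
    have hV : 0 ≤ V := Finset.sum_nonneg fun i _ => mul_nonneg
      (mul_nonneg (by linarith [h0 i]) (by linarith [h1 i])) (sq_nonneg _)
    set q := p a
    set y := x a
    have hq : 3 / 16 ≤ q * (1 - q) := by nlinarith
    have hvar : 0 ≤ q * (1 - q) * y ^ 2 := mul_nonneg (by linarith) (sq_nonneg _)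
    have key : q * (1 - q) * ((1 - q) ^ 3 + q ^ 3) ≤ 9 * (q * (1 - q)) ^ 2 := by
      have : (1 - q) ^ 3 + q ^ 3 ≤ 9 * (q * (1 - q)) := by nlinarith
      nlinarith
    have key2 := mul_le_mul_of_nonneg_right key (by positivity : 0 ≤ y ^ 4)
    have hVq := mul_nonneg hV hvar
    nlinarith

theorem subsetExp_add_centredSum_pow_four_le (s : Finset ι) {p : ι → ℝ} (h0 : ∀ i, 1 / 4 ≤ p i)
    (h1 : ∀ i, p i ≤ 3 / 4) (x : ι → ℝ) (c : ℝ) :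
    subsetExp s p (fun S => (c + centredSum s p x S) ^ 4) ≤
      72 * (c ^ 2 + ∑ i ∈ s, p i * (1 - p i) * x i ^ 2) ^ 2 := by
  have h := subsetExp_centredSum_pow_four_le s h0 h1 x
  have hV : 0 ≤ ∑ i ∈ s, p i * (1 - p i) * x i ^ 2 := Finset.sum_nonneg fun i _ => mul_nonneg
      (mul_nonneg (by linarith [h0 i]) (by linarith [h1 i])) (sq_nonneg _)
  set V := ∑ i ∈ s, p i * (1 - p i) * x i ^ 2
  have h2 : subsetExp s p (fun S => (c + centredSum s p x S) ^ 4) ≤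
      subsetExp s p (fun S => 8 * c ^ 4 + 8 * centredSum s p x S ^ 4) := by
    refine subsetExp_mono (fun i => by linarith [h0 i]) (fun i => by linarith [h1 i]) fun S _ => ?_
    set y := centredSum s p x S
    have h3 : (c + y) ^ 2 ≤ 2 * (c ^ 2 + y ^ 2) := by nlinarith [sq_nonneg (c - y)]
    have h4 : ((c + y) ^ 2) ^ 2 ≤ (2 * (c ^ 2 + y ^ 2)) ^ 2 := by gcongr
    nlinarith [sq_nonneg (c ^ 2 - y ^ 2)]
  rw [subsetExp_add, subsetExp_const, subsetExp_const_mul] at h2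
  nlinarith [mul_nonneg (sq_nonneg c) hV, sq_nonneg (c ^ 2)]

/-- A Paley–Zygmund inequality for random subset sums. -/
theorem paley_zygmund_subset (s : Finset ι) {p : ι → ℝ} (h0 : ∀ i, 1 / 4 ≤ p i)
    (h1 : ∀ i, p i ≤ 3 / 4) (x : ι → ℝ) (c : ℝ) :
    1 / 128 ≤ subsetExp s p (fun S =>
      if (c ^ 2 + ∑ i ∈ s, p i * (1 - p i) * x i ^ 2) / 4 ≤ (c + centredSum s p x S) ^ 2
      then 1 else 0) := by
  have h4 := subsetExp_add_centredSum_pow_four_le s h0 h1 x c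
  have h2 := subsetExp_add_centredSum_sq s p x c
  have hV : 0 ≤ ∑ i ∈ s, p i * (1 - p i) * x i ^ 2 := Finset.sum_nonneg fun i _ => mul_nonneg
      (mul_nonneg (by linarith [h0 i]) (by linarith [h1 i])) (sq_nonneg _)
  have h0' : ∀ i, 0 ≤ p i := fun i => by linarith [h0 i]
  have h1' : ∀ i, p i ≤ 1 := fun i => by linarith [h1 i]
  have hm0 : 0 ≤ c ^ 2 + ∑ i ∈ s, p i * (1 - p i) * x i ^ 2 := by positivity
  set m := c ^ 2 + ∑ i ∈ s, p i * (1 - p i) * x i ^ 2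
  rcases hm0.eq_or_lt with hm | hm
  · have : (fun S => if m / 4 ≤ (c + centredSum s p x S) ^ 2 then (1 : ℝ) else 0) = fun _ => 1 := by
      funext S
      rw [if_pos]
      rw [← hm]; simpa using sq_nonneg (c + centredSum s p x S)
    rw [this, subsetExp_one]; norm_num
  · set F : Finset ι → ℝ := fun S => if m / 4 ≤ (c + centredSum s p x S) ^ 2 then (1 : ℝ) else 0
    -- Off the event, `z < m / 4`; on it, `z ≤ z² / (192 m) + 48 m` by completing the square. Since
    -- the fourth moment is at most `72 m²`, taking expectations leaves `m ≤ m/4 + 3m/8 + 48 m *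
    -- prob`, so the probability is at least `1/128`.
    have hle : subsetExp s p (fun S => (c + centredSum s p x S) ^ 2) ≤
        subsetExp s p (fun S => m / 4 + (1 / (192 * m) * (c + centredSum s p x S) ^ 4 +
          48 * m * F S)) := by
      refine subsetExp_mono h0' h1' fun S _ => ?_
      simp only [F]
      set z := (c + centredSum s p x S) ^ 2 with hz
      have hz4 : (c + centredSum s p x S) ^ 4 = z ^ 2 := by rw [hz]; ring
      rw [hz4]
      have hpos : 0 ≤ 1 / (192 * m) * z ^ 2 := by positivity
      split_ifs with h
      · have : z ≤ 1 / (192 * m) * z ^ 2 + 48 * m := by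
          have : 0 ≤ (z - 96 * m) ^ 2 / (192 * m) := by positivity
          have e : (z - 96 * m) ^ 2 / (192 * m) = 1 / (192 * m) * z ^ 2 - z + 48 * m := by
            field_simp; ring
          linarith
        linarith
      · push Not at h; linarith
    rw [subsetExp_add, subsetExp_add, subsetExp_const, subsetExp_const_mul, subsetExp_const_mul,
      h2] at hle
    have : 1 / (192 * m) * subsetExp s p (fun S => (c + centredSum s p x S) ^ 4) ≤ 3 / 8 * m := by
      calc _ ≤ 1 / (192 * m) * (72 * m ^ 2) := by gcongr
        _ = 3 / 8 * m := by field_simp; norm_num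
    have h5 : 3 / 8 * m ≤ 48 * m * subsetExp s p F := by linarith
    have h6 : 0 ≤ 48 * m * (subsetExp s p F - 1 / 128) := by linarith
    have h7 := nonneg_of_mul_nonneg_right h6 (by positivity)
    linarith

/-- The sum `∑ ± y i`, the sign being `+` for `i ∈ S`. -/
noncomputable def signedSum (s : Finset ι) (y : ι → ℝ) (S : Finset ι) : ℝ :=
  ∑ i ∈ s, (if i ∈ S then 1 else -1) * y i

theorem signedSum_eq_centredSum (s : Finset ι) (y : ι → ℝ) (S : Finset ι) :
    signedSum s y S = 0 + centredSum s (fun _ => 1 / 2) (fun i => 2 * y i) S := by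
  unfold signedSum centredSum
  rw [zero_add]
  refine Finset.sum_congr rfl fun i _ => ?_
  split_ifs <;> ring

theorem subsetExp_signedSum_pow_four_le (s : Finset ι) (y : ι → ℝ) :
    subsetExp s (fun _ => 1 / 2) (fun S => signedSum s y S ^ 4) ≤ 9 * (∑ i ∈ s, y i ^ 2) ^ 2 := by
  simp only [signedSum_eq_centredSum, zero_add]
  refine (subsetExp_centredSum_pow_four_le s (fun _ => by norm_num) (fun _ => by norm_num) _).trans
    (le_of_eq ?_)
  congr 2
  exact Finset.sum_congr rfl fun i _ => by ring

theorem paley_zygmund_signedSum (s : Finset ι) (y : ι → ℝ) :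
    1 / 128 ≤ subsetExp s (fun _ => 1 / 2) (fun S =>
      if (∑ i ∈ s, y i ^ 2) / 4 ≤ signedSum s y S ^ 2 then 1 else 0) := by
  have := paley_zygmund_subset s (p := fun _ => 1 / 2) (fun _ => by norm_num)
    (fun _ => by norm_num) (fun i => 2 * y i) 0
  simp only [← signedSum_eq_centredSum] at this
  have e : (0 : ℝ) ^ 2 + ∑ i ∈ s, 1 / 2 * (1 - 1 / 2) * (2 * y i) ^ 2 = ∑ i ∈ s, y i ^ 2 := by
    rw [zero_pow two_ne_zero, zero_add]
    exact Finset.sum_congr rfl fun i _ => by ring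
  rwa [e] at this

/-- Concentration bound for a random subset sum with many large summands. -/
theorem subsetExp_concentration (s : Finset ι) {p : ℝ} (hp0 : 0 ≤ p) (hp1 : p ≤ 1 / 2)
    (x : ι → ℝ) (t : ℝ) (y : ℝ) :
    subsetExp s (fun _ => p) (fun S => if |∑ i ∈ S, x i - y| ≤ t then 1 else 0) ≤
      (1 + (1 - 2 * p) ^ (s.filter fun i => 2 * t < |x i|).card) / 2 := by
  induction s using Finset.induction_on generalizing y with
  | empty =>
    simp only [subsetExp, subsetWeight, Finset.powerset_empty, Finset.sum_singleton]
    simp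
    split_ifs <;> norm_num
  | insert a s ha ih =>
    rw [subsetExp_insert ha]
    have e : subsetExp s (fun _ => p)
        (fun S => if |∑ i ∈ insert a S, x i - y| ≤ t then (1 : ℝ) else 0) =
        subsetExp s (fun _ => p) (fun S => if |∑ i ∈ S, x i - (y - x a)| ≤ t then 1 else 0) := by
      refine subsetExp_congr fun S hS => ?_
      rw [Finset.sum_insert fun h => ha (hS h)]
      congr 3; ring
    rw [e]
    have i1 := ih y
    have i2 := ih (y - x a)
    set A := subsetExp s (fun _ => p) (fun S => if |∑ i ∈ S, x i - (y - x a)| ≤ t then (1 : ℝ) else 0)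
    set B := subsetExp s (fun _ => p) (fun S => if |∑ i ∈ S, x i - y| ≤ t then (1 : ℝ) else 0)
    rw [Finset.filter_insert]
    split_ifs with hx
    · rw [Finset.card_insert_of_notMem (by simp [ha])]
      -- Windows of radius `t` about two centres more than `2 t` apart are disjoint. Hence `p A + (1
      -- - p) B = p (A + B) + (1 - 2p) B` gains a factor `1 - 2p` on the excess over `1/2`.
      have hAB : A + B ≤ 1 := by
        rw [← subsetExp_add]
        refine (subsetExp_mono (g' := fun _ => 1) (fun _ => hp0) (fun _ => by linarith)
          fun S _ => ?_).trans_eq (subsetExp_one _ _)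
        split_ifs with h1 h2 <;> try norm_num
        have : |x a| ≤ 2 * t := by
          have : x a = (∑ i ∈ S, x i - (y - x a)) - (∑ i ∈ S, x i - y) := by ring
          rw [this]
          exact (abs_sub _ _).trans (by linarith)
        linarith
      rw [pow_succ]
      nlinarith
    · nlinarith

end RandomSubset

/-- Fubini: a bound over the random subset, valid for each fixed `ω ∈ H`, is integrated over `Ω`.
This is how every randomisation below becomes a statement about events. -/
theorem measureReal_mul_le_subsetExp {ι Ω : Type*} [DecidableEq ι] [MeasurableSpace Ω]
    (P : Measure Ω) [IsFiniteMeasure P] {s : Finset ι} {p : ι → ℝ}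
    {E : Finset ι → Set Ω} (hE : ∀ S, MeasurableSet (E S)) {H : Set Ω} (hH : MeasurableSet H)
    {c : ℝ} (hp0 : ∀ i, 0 ≤ p i) (hp1 : ∀ i, p i ≤ 1)
    (h : ∀ᵐ ω ∂P, ω ∈ H → c ≤ subsetExp s p (fun S => (E S).indicator 1 ω)) :
    c * P.real H ≤ subsetExp s p (fun S => P.real (E S)) := by
  have hi : ∀ S, Integrable ((E S).indicator (1 : Ω → ℝ)) P := fun S =>
    (integrable_const (1 : ℝ)).indicator (hE S)
  have e : subsetExp s p (fun S => P.real (E S)) =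
      ∫ ω, subsetExp s p (fun S => (E S).indicator 1 ω) ∂P := by
    unfold subsetExp
    rw [integral_finsetSum _ fun S _ => (hi S).const_mul _]
    refine Finset.sum_congr rfl fun S _ => ?_
    rw [integral_const_mul, integral_indicator_one (hE S)]
  have e2 : c * P.real H = ∫ ω, H.indicator (fun _ => c) ω ∂P := by
    rw [integral_indicator_const _ hH, smul_eq_mul, mul_comm]
  rw [e, e2]
  refine integral_mono_ae ((integrable_const c).indicator hH)
    (integrable_finsetSum _ fun S _ => (hi S).const_mul _) ?_
  filter_upwards [h] with ω hω
  by_cases hωH : ω ∈ H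
  · simpa [hωH] using hω hωH
  · simp only [hωH, not_false_eq_true, Set.indicator_of_notMem]
    refine Finset.sum_nonneg fun S _ => mul_nonneg (subsetWeight_nonneg hp0 hp1 S) ?_
    exact Set.indicator_nonneg (fun _ _ => zero_le_one) _

/-! ### Square functions of a random linear functional: a Nikishin-type factorisation and a
truncation argument. -/

section SquareFunction

theorem measureReal_le_add_of_subset_union {Ω : Type*} [MeasurableSpace Ω] {P : Measure Ω}
    [IsFiniteMeasure P] {A B C : Set Ω} (h : A ⊆ B ∪ C) : P.real A ≤ P.real B + P.real C :=
  (measureReal_mono h (measure_ne_top _ _)).trans (measureReal_union_le _ _)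

theorem tendsto_measureReal_lt_atTop {Ω : Type*} [MeasurableSpace Ω] (P : Measure Ω)
    [IsFiniteMeasure P] {Y : Ω → ℝ} (hY : Measurable Y) :
    Tendsto (fun t : ℝ => P.real {ω | t < Y ω}) atTop (𝓝 0) := by
  have h : Tendsto (fun t : ℝ => P {ω | t < Y ω}) atTop (𝓝 (P (⋂ t : ℝ, {ω | t < Y ω}))) :=
    tendsto_measure_iInter_atTop
      (fun t => (measurableSet_lt measurable_const hY).nullMeasurableSet)
      (fun a b hab ω hω => lt_of_le_of_lt hab hω) ⟨0, measure_ne_top _ _⟩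
  have e : (⋂ t : ℝ, {ω | t < Y ω}) = ∅ := by
    ext ω
    simp only [Set.mem_iInter, Set.mem_ofPred_eq, Set.mem_empty_iff_false, iff_false, not_forall,
      not_lt]
    exact ⟨Y ω, le_rfl⟩
  rw [e, measure_empty] at h
  exact (ENNReal.tendsto_toReal ENNReal.zero_ne_top).comp h

/-- Exhaustion: the complement of the union of a maximal disjoint family of bad sets contains no bad
set. The family is countable since its members have positive measure. -/
theorem exists_measurableSet_forall_subset_not {Ω : Type*} [MeasurableSpace Ω] (P : Measure Ω)
    [IsFiniteMeasure P] (bad : Set Ω → Prop) (hm : ∀ H, bad H → MeasurableSet H)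
    (hpos : ∀ H, bad H → P H ≠ 0) (δ : ENNReal)
    (h : ∀ 𝓕 : Finset (Set Ω), (∀ H ∈ 𝓕, bad H) → (𝓕 : Set (Set Ω)).PairwiseDisjoint id →
      ∑ H ∈ 𝓕, P H ≤ δ) :
    ∃ G, MeasurableSet G ∧ P Gᶜ ≤ δ ∧ ∀ H ⊆ G, ¬ bad H := by
  obtain ⟨𝓗, h𝓗⟩ := zorn_subset {𝓐 : Set (Set Ω) | (∀ H ∈ 𝓐, bad H) ∧ 𝓐.PairwiseDisjoint id}
    (fun c hc hchain => by
      refine ⟨⋃₀ c, ⟨fun H hH => ?_, ?_⟩, fun s hs => Set.subset_sUnion_of_mem hs⟩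
      · obtain ⟨a, ha, hHa⟩ := hH
        exact (hc ha).1 H hHa
      · exact (Set.pairwiseDisjoint_sUnion hchain.directedOn).2 fun a ha => (hc ha).2)
  have hbad := h𝓗.prop.1
  have hdisj := h𝓗.prop.2
  have hcount : 𝓗.Countable := by
    have := Measure.countable_meas_pos_of_disjoint_of_meas_iUnion_ne_top P
      (As := fun H : 𝓗 => (H : Set Ω)) (fun H => hm _ (hbad _ H.2))
      (fun a b hab => hdisj a.2 b.2 (fun h => hab (Subtype.ext h))) (measure_ne_top _ _)
    have e : {i : 𝓗 | 0 < P (i : Set Ω)} = Set.univ := by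
      ext i; simpa using pos_iff_ne_zero.2 (hpos _ (hbad _ i.2))
    rw [e] at this
    exact Set.countable_coe_iff.1 (Set.countable_univ_iff.1 this)
  have hmeas : MeasurableSet (⋃₀ 𝓗) := MeasurableSet.sUnion hcount fun H hH => hm H (hbad H hH)
  refine ⟨(⋃₀ 𝓗)ᶜ, hmeas.compl, ?_, fun H hHG hH => ?_⟩
  · rw [compl_compl, measure_sUnion hcount hdisj fun H hH => hm H (hbad H hH),
      ENNReal.tsum_eq_iSup_sum]
    refine iSup_le fun s => ?_
    classical
    have := h (s.map (Function.Embedding.subtype _)) (fun H hH => by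
        obtain ⟨a, -, rfl⟩ := Finset.mem_map.1 hH
        exact hbad _ a.2)
      (fun a ha b hb hab => by
        obtain ⟨a', -, rfl⟩ := Finset.mem_map.1 ha
        obtain ⟨b', -, rfl⟩ := Finset.mem_map.1 hb
        exact hdisj a'.2 b'.2 hab)
    rwa [Finset.sum_map] at this
  · have hmem : H ∈ 𝓗 := by
      have := h𝓗.le_of_ge (y := insert H 𝓗) ⟨?_, ?_⟩ (Set.subset_insert _ _)
      · exact this (Set.mem_insert _ _)
      · rintro a (rfl | ha)
        exacts [hH, hbad a ha]
      · refine hdisj.insert fun b hb _ => ?_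
        exact (Set.disjoint_left.2 fun ω hω hωb => hHG hω ⟨b, hb, hωb⟩)
    have hH0 : H = ∅ := Set.eq_empty_of_forall_notMem fun ω hω => hHG hω ⟨H, hmem, hω⟩
    exact hpos H hH (by rw [hH0, measure_empty])

variable {Ω : Type*} {ι : Type*} [Fintype ι]

/-- The random linear functional `f ↦ ∑ f i x i`. -/
def randomSum (x : ι → Ω → ℝ) (f : ι → ℝ) (ω : Ω) : ℝ := ∑ i, f i * x i ω

theorem randomSum_add (x : ι → Ω → ℝ) (f g : ι → ℝ) (ω : Ω) :
    randomSum x (fun i => f i + g i) ω = randomSum x f ω + randomSum x g ω := by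
  simp only [randomSum, add_mul, Finset.sum_add_distrib]

theorem randomSum_const_mul (x : ι → Ω → ℝ) (c : ℝ) (f : ι → ℝ) (ω : Ω) :
    randomSum x (fun i => c * f i) ω = c * randomSum x f ω := by
  simp only [randomSum, Finset.mul_sum, mul_assoc]

theorem randomSum_signedSum {J : Type*} [DecidableEq J] (s : Finset J) (x : ι → Ω → ℝ)
    (f : J → ι → ℝ) (S : Finset J) (ω : Ω) :
    randomSum x (fun i => signedSum s (fun j => f j i) S) ω =
      signedSum s (fun j => randomSum x (f j) ω) S := by
  simp only [randomSum, signedSum, Finset.sum_mul, Finset.mul_sum]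
  rw [Finset.sum_comm]
  simp only [mul_assoc]

variable [MeasurableSpace Ω]

theorem measurable_randomSum {x : ι → Ω → ℝ} (hx : ∀ i, Measurable (x i)) (f : ι → ℝ) :
    Measurable (randomSum x f) :=
  Finset.measurable_sum _ fun i _ => (hx i).const_mul _

/-- Passage from subset sums to coefficients in `[-1, 1]`: `p = f / 4 + 1 / 2` lies in `[1/4, 3/4]`,
and `∑ p i * x i` is the mean of a random subset sum. Paley–Zygmund makes some subset sum large
wherever this mean is. As `f = 4 p - 2`, the constants are `10 = 4 * 2 + 2` and `129 = 128 + 1`. -/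
theorem measureReal_le_abs_randomSum (P : Measure Ω) [IsFiniteMeasure P] {x : ι → Ω → ℝ}
    (hx : ∀ i, Measurable (x i)) {t ε : ℝ} (ht : 0 < t)
    (h : ∀ S : Finset ι, P.real {ω | t ≤ |∑ i ∈ S, x i ω|} ≤ ε) {f : ι → ℝ}
    (hf : ∀ i, |f i| ≤ 1) : P.real {ω | 10 * t ≤ |randomSum x f ω|} ≤ 129 * ε := by
  classical
  set p : ι → ℝ := fun i => f i / 4 + 1 / 2 with hp
  have h0 : ∀ i, 1 / 4 ≤ p i := fun i => by have := (abs_le.1 (hf i)).1; simp only [hp]; linarith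
  have h1 : ∀ i, p i ≤ 3 / 4 := fun i => by have := (abs_le.1 (hf i)).2; simp only [hp]; linarith
  have h0' : ∀ i, 0 ≤ p i := fun i => by linarith [h0 i]
  have h1' : ∀ i, p i ≤ 1 := fun i => by linarith [h1 i]
  have hE : ∀ S : Finset ι, MeasurableSet {ω | t ≤ |∑ i ∈ S, x i ω|} := fun S =>
    measurableSet_le measurable_const
      (continuous_abs.measurable.comp (Finset.measurable_sum S fun i _ => hx i))
  have hH : MeasurableSet {ω | 2 * t ≤ |randomSum x p ω|} :=
    measurableSet_le measurable_const (continuous_abs.measurable.comp (measurable_randomSum hx p))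
  have key : 1 / 128 * P.real {ω | 2 * t ≤ |randomSum x p ω|} ≤ ε := by
    refine (measureReal_mul_le_subsetExp P (s := Finset.univ) hE hH h0' h1' ?_).trans
      ((subsetExp_mono h0' h1' fun S _ => h S).trans_eq (subsetExp_const _ _ _))
    refine Eventually.of_forall fun ω hω => ?_
    refine (paley_zygmund_subset Finset.univ h0 h1 (fun i => x i ω) (randomSum x p ω)).trans
      (subsetExp_mono h0' h1' fun S _ => ?_)
    have e : randomSum x p ω + centredSum Finset.univ p (fun i => x i ω) S = ∑ i ∈ S, x i ω := by
      unfold randomSum centredSum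
      rw [← Finset.sum_add_distrib, ← Finset.sum_subset (Finset.subset_univ S)]
      · refine Finset.sum_congr rfl fun i hi => ?_
        simp [hi]; ring
      · intro i _ hi
        simp [hi]
    rw [e]
    split_ifs with hc
    · have hnn : 0 ≤ ∑ i, p i * (1 - p i) * x i ω ^ 2 := Finset.sum_nonneg fun i _ =>
        mul_nonneg (mul_nonneg (h0' i) (sub_nonneg.2 (h1' i))) (sq_nonneg _)
      have h2 : t ^ 2 ≤ (∑ i ∈ S, x i ω) ^ 2 := by
        have : (2 * t) ^ 2 ≤ randomSum x p ω ^ 2 := by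
          rw [← sq_abs (randomSum x p ω)]
          exact pow_le_pow_left₀ (by positivity) hω 2
        nlinarith
      have h3 : t ≤ |∑ i ∈ S, x i ω| := by
        have := sq_le_sq.1 h2
        rwa [abs_of_pos ht] at this
      rw [Set.indicator_of_mem (show ω ∈ {ω | t ≤ |∑ i ∈ S, x i ω|} from h3)]
      rfl
    · exact Set.indicator_nonneg (fun _ _ => zero_le_one) _
  have hsub : {ω | 10 * t ≤ |randomSum x f ω|} ⊆
      {ω | 2 * t ≤ |randomSum x p ω|} ∪ {ω | t ≤ |∑ i ∈ Finset.univ, x i ω|} := by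
    intro ω hω
    by_contra hcon
    simp only [Set.mem_union, Set.mem_ofPred_eq, not_or, not_le] at hcon hω
    have e : randomSum x f ω = 4 * randomSum x p ω - 2 * ∑ i, x i ω := by
      simp only [randomSum, hp, Finset.mul_sum, ← Finset.sum_sub_distrib]
      exact Finset.sum_congr rfl fun i _ => by ring
    have : |randomSum x f ω| ≤ 4 * |randomSum x p ω| + 2 * |∑ i, x i ω| := by
      rw [e]
      refine (abs_sub _ _).trans ?_
      rw [abs_mul, abs_mul]; norm_num
    linarith [hcon.1, hcon.2]
  have := measureReal_le_add_of_subset_union (P := P) hsub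
  linarith [h Finset.univ]

/-- Every signed combination `∑ ± c j * f j` has coefficients bounded by `1`, and by Paley–Zygmund a
random choice of signs detects a large sum of squares with probability at least `1/128`. -/
theorem measureReal_le_sum_sq_randomSum (P : Measure Ω) [IsFiniteMeasure P] {x : ι → Ω → ℝ}
    (hx : ∀ i, Measurable (x i)) {t ε : ℝ} (ht : 0 < t)
    (h : ∀ f : ι → ℝ, (∀ i, |f i| ≤ 1) → P.real {ω | t ≤ |randomSum x f ω|} ≤ ε)
    {J : Type*} (s : Finset J) (c : J → ℝ) (f : J → ι → ℝ) (hc : ∑ j ∈ s, |c j| ≤ 1)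
    (hf : ∀ j i, |f j i| ≤ 1) :
    P.real {ω | 4 * t ^ 2 ≤ ∑ j ∈ s, (c j * randomSum x (f j) ω) ^ 2} ≤ 128 * ε := by
  classical
  have hE : ∀ S : Finset J, MeasurableSet
      {ω | t ≤ |randomSum x (fun i => signedSum s (fun j => c j * f j i) S) ω|} := fun S =>
    measurableSet_le measurable_const (continuous_abs.measurable.comp (measurable_randomSum hx _))
  have hH : MeasurableSet {ω | 4 * t ^ 2 ≤ ∑ j ∈ s, (c j * randomSum x (f j) ω) ^ 2} :=
    measurableSet_le measurable_const
      (Finset.measurable_sum s fun j _ => ((measurable_randomSum hx _).const_mul _).pow_const 2)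
  have hbd : ∀ S i, |signedSum s (fun j => c j * f j i) S| ≤ 1 := fun S i => by
    unfold signedSum
    refine (Finset.abs_sum_le_sum_abs _ _).trans ((Finset.sum_le_sum fun j _ => ?_).trans hc)
    rw [abs_mul, abs_mul]
    have : |(if j ∈ S then (1 : ℝ) else -1)| = 1 := by split_ifs <;> simp
    rw [this, one_mul]
    exact mul_le_of_le_one_right (abs_nonneg _) (hf j i)
  have key : 1 / 128 * P.real {ω | 4 * t ^ 2 ≤ ∑ j ∈ s, (c j * randomSum x (f j) ω) ^ 2} ≤ ε := by
    refine (measureReal_mul_le_subsetExp P (s := s) (p := fun _ => 1 / 2) hE hH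
      (fun _ => by norm_num) (fun _ => by norm_num) ?_).trans
      ((subsetExp_mono (fun _ => by norm_num) (fun _ => by norm_num)
        fun S _ => h _ (hbd S)).trans_eq (subsetExp_const _ _ _))
    refine Eventually.of_forall fun ω hω => ?_
    refine (paley_zygmund_signedSum s (fun j => c j * randomSum x (f j) ω)).trans
      (subsetExp_mono (fun _ => by norm_num) (fun _ => by norm_num) fun S _ => ?_)
    split_ifs with hc
    · have h2 : t ^ 2 ≤ signedSum s (fun j => c j * randomSum x (f j) ω) S ^ 2 := by
        have : 4 * t ^ 2 ≤ ∑ j ∈ s, (c j * randomSum x (f j) ω) ^ 2 := hω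
        linarith
      have h3 := sq_le_sq.1 h2
      rw [abs_of_pos ht] at h3
      have e := randomSum_signedSum s x (fun j i => c j * f j i) S ω
      simp only [randomSum_const_mul] at e
      rw [Set.indicator_of_mem (show ω ∈ {ω | t ≤ |randomSum x
        (fun i => signedSum s (fun j => c j * f j i) S) ω|} from by
          show t ≤ _
          rw [e]; exact h3)]
      rfl
    · exact Set.indicator_nonneg (fun _ _ => zero_le_one) _
  linarith

/-- A form of Nikishin's theorem: off a small event the functional is of weak type `(1, 1)`. -/
theorem exists_weak_type_randomSum (P : Measure Ω) [IsProbabilityMeasure P] {x : ι → Ω → ℝ}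
    (hx : ∀ i, Measurable (x i)) {t ε : ℝ} (ht : 0 < t)
    (h : ∀ f : ι → ℝ, (∀ i, |f i| ≤ 1) → P.real {ω | t ≤ |randomSum x f ω|} ≤ ε) :
    ∃ G, MeasurableSet G ∧ P.real Gᶜ ≤ 128 * ε ∧ ∀ f : ι → ℝ, (∀ i, |f i| ≤ 1) → ∀ s, 0 < s →
      P.real (G ∩ {ω | s ≤ |randomSum x f ω|}) ≤ 2 * t / s := by
  have hε : 0 ≤ ε := measureReal_nonneg.trans (h 0 (by simp))
  obtain ⟨G, hG, hGδ, hGbad⟩ := exists_measurableSet_forall_subset_not P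
    (fun H => MeasurableSet H ∧ ∃ f : ι → ℝ, (∀ i, |f i| ≤ 1) ∧ ∃ s, 0 < s ∧
      H ⊆ {ω | s ≤ |randomSum x f ω|} ∧ 2 * t / s < P.real H)
    (fun H hH => hH.1)
    (fun H ⟨_, f, _, s, hs, _, hlt⟩ h0 => by
      rw [Measure.real, h0, ENNReal.toReal_zero] at hlt
      exact absurd hlt (not_lt.2 (by positivity))) (ENNReal.ofReal (128 * ε))
    (fun 𝓕 hbad hdisj => by
      choose! hm f hf s hs hsub hlt using hbad
      have hsum : P.real (⋃ H ∈ 𝓕, H) = ∑ H ∈ 𝓕, P.real H :=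
        measureReal_biUnion_finset hdisj hm
      -- The weight `2 t / s H` is less than `P H`, so disjointness keeps the total weight at most
      -- `1`. On `H` the weighted value has modulus at least `2 t`, so the sum of squares is at
      -- least `4 t²` on the whole union.
      have hc : ∑ H ∈ 𝓕, |if H ∈ 𝓕 then 2 * t / s H else 0| ≤ 1 := by
        calc _ ≤ ∑ H ∈ 𝓕, P.real H := Finset.sum_le_sum fun H hH => by
              have := hs H hH
              rw [if_pos hH, abs_of_nonneg (by positivity)]
              exact (hlt H hH).le
          _ = P.real (⋃ H ∈ 𝓕, H) := hsum.symm
          _ ≤ 1 := measureReal_le_one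
      have hf' : ∀ H i, |(if H ∈ 𝓕 then f H else 0) i| ≤ 1 := fun H i => by
        split_ifs with hH
        · exact hf H hH i
        · simp
      have := measureReal_le_sum_sq_randomSum P hx ht h 𝓕 _ _ hc hf'
      have hle : P.real (⋃ H ∈ 𝓕, H) ≤ 128 * ε := by
        refine (measureReal_mono fun ω hω => ?_).trans this
        simp only [Set.mem_iUnion, exists_prop] at hω
        obtain ⟨H, hH, hωH⟩ := hω
        have h1 : s H ≤ |randomSum x (f H) ω| := hsub H hH hωH
        have hsH := hs H hH
        refine le_trans ?_ (Finset.single_le_sum (f := fun H =>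
          ((if H ∈ 𝓕 then 2 * t / s H else 0) * randomSum x (if H ∈ 𝓕 then f H else 0) ω) ^ 2)
          (fun _ _ => sq_nonneg _) hH)
        simp only [hH, if_true]
        rw [mul_pow, ← sq_abs (randomSum x (f H) ω)]
        calc 4 * t ^ 2 = (2 * t / s H) ^ 2 * s H ^ 2 := by field_simp; ring
          _ ≤ _ := by gcongr
      rw [hsum] at hle
      calc ∑ H ∈ 𝓕, P H = ∑ H ∈ 𝓕, ENNReal.ofReal (P.real H) :=
            Finset.sum_congr rfl fun H _ => (ofReal_measureReal).symm
        _ = ENNReal.ofReal (∑ H ∈ 𝓕, P.real H) :=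
            (ENNReal.ofReal_sum_of_nonneg fun _ _ => measureReal_nonneg).symm
        _ ≤ _ := ENNReal.ofReal_le_ofReal hle)
  refine ⟨G, hG, ENNReal.toReal_le_of_le_ofReal (by positivity) hGδ, fun f hf s hs => ?_⟩
  by_contra hcon
  push Not at hcon
  refine hGbad _ Set.inter_subset_left ⟨hG.inter ?_, f, hf, s, hs, Set.inter_subset_right, hcon⟩
  exact measurableSet_le measurable_const
    (continuous_abs.measurable.comp (measurable_randomSum hx _))

theorem abs_sub_clamp_sq_le {M z : ℝ} (hM : 0 < M) :
    (z - max (-M) (min M z)) ^ 2 ≤ z ^ 4 / M ^ 2 := by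
  rw [le_div_iff₀ (by positivity), ← mul_pow]
  have h : |(z - max (-M) (min M z)) * M| ≤ |z ^ 2| := by
    rw [abs_mul, abs_of_pos hM, abs_of_nonneg (sq_nonneg z)]
    rcases le_total M z with h1 | h1
    · rw [min_eq_left h1, max_eq_right (by linarith), abs_of_nonneg (by linarith)]
      nlinarith
    · rw [min_eq_right h1]
      rcases le_total (-M) z with h2 | h2
      · rw [max_eq_right h2]; simp [sq_nonneg]
      · rw [max_eq_left h2, abs_of_nonpos (by linarith)]
        nlinarith
  have := sq_le_sq.2 h
  calc _ ≤ (z ^ 2) ^ 2 := this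
    _ = z ^ 4 := by ring

/-- A signed sum of the `f j` is split into its truncation at `384` and a remainder. The truncation
obeys the weak type bound; the remainders over all signs, suitably rescaled, form another admissible
family, to which the bound at level `2 * s` applies. -/
theorem square_function_step (Q : Measure Ω) [IsFiniteMeasure Q] {x : ι → Ω → ℝ}
    (hx : ∀ i, Measurable (x i)) {K s R : ℝ} (hs : 0 < s)
    (hK : ∀ f : ι → ℝ, (∀ i, |f i| ≤ 1) → ∀ s, 0 < s →
      Q.real {ω | s ≤ |randomSum x f ω|} ≤ K / s)
    (hR : ∀ (J : Type) [Fintype J] (f : J → ι → ℝ), (∀ i, ∑ j, f j i ^ 2 ≤ 1) →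
      Q.real {ω | (2 * s) ^ 2 < ∑ j, randomSum x (f j) ω ^ 2} ≤ R)
    (J : Type) [Fintype J] (f : J → ι → ℝ) (hf : ∀ i, ∑ j, f j i ^ 2 ≤ 1) :
    Q.real {ω | s ^ 2 < ∑ j, randomSum x (f j) ω ^ 2} ≤ 393216 * K / s + R := by
  classical
  set w : Finset J → ℝ := subsetWeight Finset.univ (fun _ => 1 / 2) with hw
  have hw0 : ∀ S, 0 ≤ w S := subsetWeight_nonneg (fun _ => by norm_num) (fun _ => by norm_num)
  set z : Finset J → ι → ℝ := fun S i => signedSum Finset.univ (fun j => f j i) S with hz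
  set u : Finset J → ι → ℝ := fun S i => max (-384) (min 384 (z S i)) with hu
  set r : Finset J → ι → ℝ := fun S i => z S i - u S i with hr
  have hexp : ∀ g : Finset J → ℝ, subsetExp Finset.univ (fun _ => 1 / 2) g = ∑ S, w S * g S :=
    fun g => by rw [subsetExp, Finset.powerset_univ]
  -- The truncation error is at most `z⁴ / 384²` and the fourth moment of a signed sum is at most
  -- `9`. As `384² = 9 * 128²`, scaling the remainders by `128` gives exactly an admissible family.
  have hr1 : ∀ i, ∑ S, (128 * √(w S) * r S i) ^ 2 ≤ 1 := fun i => by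
    calc ∑ S, (128 * √(w S) * r S i) ^ 2 = ∑ S, 16384 * (w S * r S i ^ 2) :=
          Finset.sum_congr rfl fun S _ => by
            rw [mul_pow, mul_pow, Real.sq_sqrt (hw0 S)]; ring
      _ ≤ ∑ S, 16384 * (w S * (z S i ^ 4 / 384 ^ 2)) := by
          gcongr with S _
          · exact hw0 S
          · exact abs_sub_clamp_sq_le (by norm_num)
      _ = 1 / 9 * ∑ S, w S * z S i ^ 4 := by
          rw [Finset.mul_sum]
          exact Finset.sum_congr rfl fun S _ => by ring
      _ ≤ 1 / 9 * (9 * (∑ j, f j i ^ 2) ^ 2) := by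
          rw [← hexp fun S => z S i ^ 4]
          gcongr
          exact subsetExp_signedSum_pow_four_le _ _
      _ ≤ 1 := by
          have : (∑ j, f j i ^ 2) ^ 2 ≤ 1 :=
            pow_le_one₀ (Finset.sum_nonneg fun _ _ => sq_nonneg _) (hf i)
          linarith
  -- The new family is indexed by the sign patterns, which is why the hypothesis quantifies over all
  -- finite index types.
  have hRr := hR (Finset J) (fun S i => 128 * √(w S) * r S i) hr1
  set B : Set Ω := {ω | (2 * s) ^ 2 <
    ∑ S : Finset J, randomSum x (fun i => 128 * √(w S) * r S i) ω ^ 2} with hB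
  have hBm : MeasurableSet B := measurableSet_lt measurable_const
    (Finset.measurable_sum _ fun S _ => (measurable_randomSum hx _).pow_const 2)
  set A : Set Ω := {ω | s ^ 2 < ∑ j, randomSum x (f j) ω ^ 2} with hA
  have hAm : MeasurableSet A := measurableSet_lt measurable_const
    (Finset.measurable_sum _ fun S _ => (measurable_randomSum hx _).pow_const 2)
  have hE : ∀ S : Finset J, MeasurableSet {ω | s / 4 ≤ |randomSum x (u S) ω|} := fun S =>
    measurableSet_le measurable_const (continuous_abs.measurable.comp (measurable_randomSum hx _))
  have hEb : ∀ S : Finset J, Q.real {ω | s / 4 ≤ |randomSum x (u S) ω|} ≤ 1536 * K / s := by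
    intro S
    have h1 := hK (fun i => 1 / 384 * u S i) (fun i => by
      rw [abs_mul, abs_of_pos (by norm_num : (0 : ℝ) < 1 / 384)]
      have : |u S i| ≤ 384 := abs_le.2 ⟨le_max_left _ _, max_le (by norm_num) (min_le_left _ _)⟩
      linarith) (s / 1536) (by positivity)
    have e : {ω | s / 1536 ≤ |randomSum x (fun i => 1 / 384 * u S i) ω|} =
        {ω | s / 4 ≤ |randomSum x (u S) ω|} := by
      ext ω
      simp only [Set.mem_ofPred_eq, randomSum_const_mul, abs_mul]
      rw [abs_of_pos (by norm_num : (0 : ℝ) < 1 / 384)]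
      constructor <;> intro h <;> linarith
    rw [e] at h1
    refine h1.trans (le_of_eq ?_)
    field_simp
  have key : 1 / 256 * Q.real (A \ B) ≤ 1536 * K / s := by
    refine (measureReal_mul_le_subsetExp Q (s := Finset.univ) (p := fun _ => 1 / 2) hE
      (hAm.diff hBm) (fun _ => by norm_num) (fun _ => by norm_num) ?_).trans
      ((subsetExp_mono (fun _ => by norm_num) (fun _ => by norm_num)
        fun S _ => hEb S).trans_eq (subsetExp_const _ _ _))
    refine Eventually.of_forall fun ω hω => ?_
    have hωA : s ^ 2 < ∑ j, randomSum x (f j) ω ^ 2 := hω.1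
    have hωB : ∑ S : Finset J, randomSum x (fun i => 128 * √(w S) * r S i) ω ^ 2 ≤ (2 * s) ^ 2 :=
      not_lt.1 hω.2
    have hrB : subsetExp Finset.univ (fun _ => 1 / 2) (fun S => randomSum x (r S) ω ^ 2) ≤
        s ^ 2 / 4096 := by
      rw [hexp]
      have : ∑ S : Finset J, randomSum x (fun i => 128 * √(w S) * r S i) ω ^ 2 =
          16384 * ∑ S, w S * randomSum x (r S) ω ^ 2 := by
        rw [Finset.mul_sum]
        refine Finset.sum_congr rfl fun S _ => ?_
        rw [randomSum_const_mul, mul_pow, mul_pow, Real.sq_sqrt (hw0 S)]; ring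
      rw [this] at hωB
      linarith
    -- With probability at least `1/128` over the signs the signed sum is at least `s / 2` in
    -- modulus. By Chebyshev the remainder reaches `s / 4` with probability at most `1/256`, so the
    -- truncated part reaches `s / 4` with probability at least `1/256`.
    have hpz := paley_zygmund_signedSum Finset.univ (fun j => randomSum x (f j) ω)
    have hle : subsetExp Finset.univ (fun _ => 1 / 2) (fun S =>
        if (∑ j, randomSum x (f j) ω ^ 2) / 4 ≤
          signedSum Finset.univ (fun j => randomSum x (f j) ω) S ^ 2 then (1 : ℝ) else 0) ≤
        subsetExp Finset.univ (fun _ => 1 / 2) (fun S =>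
          ({ω | s / 4 ≤ |randomSum x (u S) ω|} : Set Ω).indicator 1 ω +
            16 / s ^ 2 * randomSum x (r S) ω ^ 2) := by
      refine subsetExp_mono (fun _ => by norm_num) (fun _ => by norm_num) fun S _ => ?_
      have hnn : 0 ≤ 16 / s ^ 2 * randomSum x (r S) ω ^ 2 := by positivity
      have hin : 0 ≤ ({ω | s / 4 ≤ |randomSum x (u S) ω|} : Set Ω).indicator (1 : Ω → ℝ) ω :=
        Set.indicator_nonneg (fun _ _ => zero_le_one) _
      split_ifs with hc
      · by_cases hm : s / 4 ≤ |randomSum x (u S) ω|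
        · rw [Set.indicator_of_mem (show ω ∈ {ω | s / 4 ≤ |randomSum x (u S) ω|} from hm)]
          simp only [Pi.one_apply]; linarith
        · have e : signedSum Finset.univ (fun j => randomSum x (f j) ω) S =
              randomSum x (u S) ω + randomSum x (r S) ω := by
            rw [← randomSum_signedSum, ← randomSum_add]
            congr 1
            funext i
            simp only [hr, hz]; ring
          rw [e] at hc
          have h1 : (s / 2) ^ 2 ≤ (randomSum x (u S) ω + randomSum x (r S) ω) ^ 2 := by linarith
          have h2 := sq_le_sq.1 h1
          rw [abs_of_pos (by positivity : 0 < s / 2)] at h2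
          have h3 := abs_add_le (randomSum x (u S) ω) (randomSum x (r S) ω)
          push Not at hm
          have h4 : s / 4 ≤ |randomSum x (r S) ω| := by linarith
          have h5 : (s / 4) ^ 2 ≤ randomSum x (r S) ω ^ 2 := by
            rw [← sq_abs (randomSum x (r S) ω)]; gcongr
          have h6 : 1 ≤ 16 / s ^ 2 * randomSum x (r S) ω ^ 2 := by
            calc (1 : ℝ) = 16 / s ^ 2 * (s / 4) ^ 2 := by field_simp; norm_num
              _ ≤ _ := by gcongr
          linarith
      · linarith
    rw [subsetExp_add, subsetExp_const_mul] at hle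
    have h7 : 16 / s ^ 2 * subsetExp Finset.univ (fun _ => 1 / 2)
        (fun S => randomSum x (r S) ω ^ 2) ≤ 1 / 256 := by
      calc _ ≤ 16 / s ^ 2 * (s ^ 2 / 4096) := by gcongr
        _ = 1 / 256 := by field_simp; norm_num
    linarith
  have hAB : Q.real A ≤ Q.real (A \ B) + Q.real B := by
    refine measureReal_le_add_of_subset_union fun ω hω => ?_
    by_cases h : ω ∈ B
    · exact Or.inr h
    · exact Or.inl ⟨hω, h⟩
  have e : 393216 * K / s = 256 * (1536 * K / s) := by ring
  rw [e]
  linarith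

/-- A functional of weak type `(1, 1)` has square functions of weak type `(1, 1)`. -/
theorem square_function_weak_type (Q : Measure Ω) [IsFiniteMeasure Q] {x : ι → Ω → ℝ}
    (hx : ∀ i, Measurable (x i)) {K : ℝ}
    (hK : ∀ f : ι → ℝ, (∀ i, |f i| ≤ 1) → ∀ s, 0 < s →
      Q.real {ω | s ≤ |randomSum x f ω|} ≤ K / s)
    (J : Type) [Fintype J] (f : J → ι → ℝ) (hf : ∀ i, ∑ j, f j i ^ 2 ≤ 1) {s : ℝ} (hs : 0 < s) :
    Q.real {ω | s ^ 2 < ∑ j, randomSum x (f j) ω ^ 2} ≤ 786432 * K / s := by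
  have hK0 : 0 ≤ K := by
    have := measureReal_nonneg.trans (hK 0 (by simp) 1 one_pos)
    simpa using this
  -- A crude Cauchy–Schwarz majorant, common to all admissible families. It depends on the number of
  -- summands but only starts the iteration and disappears in the limit.
  set Y : Ω → ℝ := fun ω => Fintype.card ι * ∑ i, x i ω ^ 2 with hY
  have hYm : Measurable Y :=
    (Finset.measurable_sum _ fun i _ => (hx i).pow_const 2).const_mul _
  have hYle : ∀ (J : Type) [Fintype J] (f : J → ι → ℝ), (∀ i, ∑ j, f j i ^ 2 ≤ 1) → ∀ ω,
      ∑ j, randomSum x (f j) ω ^ 2 ≤ Y ω := by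
    intro J _ f hf ω
    calc ∑ j, randomSum x (f j) ω ^ 2 ≤ ∑ j, Fintype.card ι * ∑ i, (f j i * x i ω) ^ 2 := by
          gcongr with j _
          exact sq_sum_le_card_mul_sum_sq
      _ = Fintype.card ι * ∑ i, (∑ j, f j i ^ 2) * x i ω ^ 2 := by
          rw [← Finset.mul_sum, Finset.sum_comm]
          simp only [mul_pow, Finset.sum_mul]
      _ ≤ Fintype.card ι * ∑ i, 1 * x i ω ^ 2 := by
          gcongr with i _
          exact hf i
      _ = Y ω := by simp [hY]
  -- Doubling the level `n` times sums `393216 * K / (2 ^ k * s)` over `k < n`; the full series is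
  -- `786432 * K / s`.
  have main : ∀ n : ℕ, ∀ s : ℝ, 0 < s → ∀ (J : Type) [Fintype J] (f : J → ι → ℝ),
      (∀ i, ∑ j, f j i ^ 2 ≤ 1) →
      Q.real {ω | s ^ 2 < ∑ j, randomSum x (f j) ω ^ 2} ≤
        786432 * K / s * (1 - 1 / 2 ^ n) + Q.real {ω | (2 ^ n * s) ^ 2 < Y ω} := by
    intro n
    induction n with
    | zero =>
      intro s hs J _ f hf
      simp only [pow_zero, div_one, sub_self, mul_zero, one_mul, zero_add]
      exact measureReal_mono fun ω hω => lt_of_lt_of_le hω (hYle J f hf ω)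
    | succ n ih =>
      intro s hs J _ f hf
      have h2s : 0 < 2 * s := by positivity
      refine (square_function_step Q hx hs hK (fun J _ f hf => ih (2 * s) h2s J f hf) J f
        hf).trans (le_of_eq ?_)
      have e1 : (2 : ℝ) ^ n * (2 * s) = 2 ^ (n + 1) * s := by ring
      rw [e1, ← add_assoc]
      congr 1
      rw [pow_succ]
      field_simp
      ring
  have hlim : Tendsto (fun n : ℕ => 786432 * K / s + Q.real {ω | (2 ^ n * s) ^ 2 < Y ω}) atTop
      (𝓝 (786432 * K / s + 0)) := by
    refine Tendsto.const_add _ ((tendsto_measureReal_lt_atTop Q hYm).comp ?_)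
    refine (tendsto_pow_atTop two_ne_zero).comp ?_
    exact (tendsto_pow_atTop_atTop_of_one_lt (by norm_num : (1 : ℝ) < 2)).atTop_mul_const hs
  rw [add_zero] at hlim
  refine ge_of_tendsto' hlim fun n => (main n s hs J f hf).trans ?_
  have h0 : 0 ≤ 786432 * K / s := by positivity
  have h1 : (0 : ℝ) ≤ 1 / 2 ^ n := by positivity
  nlinarith

/-- Square functions `(∑ (T f)²)^{1/2}`, `∑ f² ≤ 1`, of a functional `T f = ∑ f i x i` are bounded
in probability in terms of the sums `∑_{i ∈ S} x i`. -/
theorem exists_square_function_bound (P : Measure Ω) [IsProbabilityMeasure P] {C : ℝ → ℝ}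
    (hC : ∀ ε, 0 < ε → 0 < C ε) {ε : ℝ} (hε : 0 < ε) :
    ∃ K : ℝ, 0 < K ∧ ∀ (ι : Type) [Fintype ι] (x : ι → Ω → ℝ), (∀ i, Measurable (x i)) →
      (∀ ε, 0 < ε → ∀ S : Finset ι, P.real {ω | C ε ≤ |∑ i ∈ S, x i ω|} ≤ ε) →
      ∀ (J : Type) [Fintype J] (f : J → ι → ℝ), (∀ i, ∑ j, f j i ^ 2 ≤ 1) →
        P.real {ω | K < ∑ j, randomSum x (f j) ω ^ 2} ≤ ε := by
  -- `33024 = 2 * 128 * 129`: the event discarded in the factorisation has probability at most `ε /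
  -- 2`, and the level `2 * K₀ / ε` leaves another `ε / 2` to the weak type bound.
  set ε₁ := ε / 33024 with hε₁
  have hε₁0 : 0 < ε₁ := by positivity
  have ht := hC ε₁ hε₁0
  set t := C ε₁
  set K₀ := 786432 * (2 * (10 * t)) with hK₀
  refine ⟨(2 * K₀ / ε) ^ 2, by positivity, fun ι _ x hx h J _ f hf => ?_⟩
  obtain ⟨G, hG, hGε, hGw⟩ := exists_weak_type_randomSum P hx (by positivity : 0 < 10 * t)
    fun f hf => measureReal_le_abs_randomSum P hx ht (h ε₁ hε₁0) hf
  have hm : ∀ (g : ι → ℝ) (s : ℝ), MeasurableSet {ω | s ≤ |randomSum x g ω|} := fun g s =>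
    measurableSet_le measurable_const (continuous_abs.measurable.comp (measurable_randomSum hx _))
  have hQ := square_function_weak_type (P.restrict G) hx (K := 2 * (10 * t))
    (fun g hg s hs => by
      rw [measureReal_restrict_apply (hm g s), Set.inter_comm]
      exact hGw g hg s hs) J f hf (s := 2 * K₀ / ε) (by positivity)
  have hAm : MeasurableSet {ω | (2 * K₀ / ε) ^ 2 < ∑ j, randomSum x (f j) ω ^ 2} :=
    measurableSet_lt measurable_const
      (Finset.measurable_sum _ fun S _ => (measurable_randomSum hx _).pow_const 2)
  rw [measureReal_restrict_apply hAm] at hQ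
  set A := {ω | (2 * K₀ / ε) ^ 2 < ∑ j, randomSum x (f j) ω ^ 2}
  have hsplit : P.real A ≤ P.real (A ∩ G) + P.real Gᶜ := by
    refine measureReal_le_add_of_subset_union fun ω hω => ?_
    by_cases h : ω ∈ G
    · exact Or.inl ⟨hω, h⟩
    · exact Or.inr h
  have hK₀0 : K₀ ≠ 0 := by positivity
  have e : K₀ / (2 * K₀ / ε) = ε / 2 := by field_simp
  rw [← hK₀, e] at hQ
  have : 128 * (129 * ε₁) = ε / 2 := by rw [hε₁]; ring
  linarith

end SquareFunction

/-! ### Exhaustive charges with values in random variables and the events on which they are bounded.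
-/

section Charge

variable {𝓧 : Type*} [MeasurableSpace 𝓧] {Ω : Type*} [MeasurableSpace Ω]

/-- A finitely additive set function with values in the random variables, which is small on the
members of disjoint sequences. -/
structure IsExhaustiveCharge (P : Measure Ω) (ν : Set 𝓧 → Ω → ℝ) : Prop where
  measurable : ∀ B, Measurable (ν B)
  additive : ∀ A B, MeasurableSet A → MeasurableSet B → Disjoint A B →
    ν (A ∪ B) =ᵐ[P] fun ω => ν A ω + ν B ω
  exhaustive : ∀ B : ℕ → Set 𝓧, (∀ k, MeasurableSet (B k)) →
    Pairwise (fun i j => Disjoint (B i) (B j)) →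
    Tendsto (fun k => P.real {ω | 1 < |ν (B k) ω|}) atTop (𝓝 0)

/-- The values of `ν` on the measurable subsets of `A` are bounded in probability on `H`. -/
def BoundedOn (P : Measure Ω) (ν : Set 𝓧 → Ω → ℝ) (A : Set 𝓧) (H : Set Ω) : Prop :=
  ∀ ε : ℝ, 0 < ε → ∃ C : ℝ, ∀ B ⊆ A, MeasurableSet B → P.real (H ∩ {ω | C < |ν B ω|}) ≤ ε

variable {P : Measure Ω} {ν : Set 𝓧 → Ω → ℝ}

theorem BoundedOn.mono [IsFiniteMeasure P] {A A' : Set 𝓧} {H H' : Set Ω}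
    (h : BoundedOn P ν A H) (hA : A' ⊆ A) (hH : H' ⊆ H) : BoundedOn P ν A' H' := by
  intro ε hε
  obtain ⟨C, hC⟩ := h ε hε
  exact ⟨C, fun B hB hBm => (measureReal_mono (Set.inter_subset_inter_left _ hH)
    (measure_ne_top _ _)).trans (hC B (hB.trans hA) hBm)⟩

theorem BoundedOn.union [IsFiniteMeasure P] {A : Set 𝓧} {H H' : Set Ω}
    (h : BoundedOn P ν A H) (h' : BoundedOn P ν A H') : BoundedOn P ν A (H ∪ H') := by
  intro ε hε
  obtain ⟨C, hC⟩ := h (ε / 2) (by positivity)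
  obtain ⟨C', hC'⟩ := h' (ε / 2) (by positivity)
  refine ⟨max C C', fun B hB hBm => ?_⟩
  have : P.real ((H ∪ H') ∩ {ω | max C C' < |ν B ω|}) ≤
      P.real (H ∩ {ω | C < |ν B ω|}) + P.real (H' ∩ {ω | C' < |ν B ω|}) := by
    refine measureReal_le_add_of_subset_union ?_
    rintro ω ⟨hω | hω, hlt⟩
    · exact Or.inl ⟨hω, show C < |ν B ω| from lt_of_le_of_lt (le_max_left _ _) hlt⟩
    · exact Or.inr ⟨hω, show C' < |ν B ω| from lt_of_le_of_lt (le_max_right _ _) hlt⟩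
  linarith [hC B hB hBm, hC' B hB hBm]

theorem tendsto_measureReal_iUnion_diff_zero [IsFiniteMeasure P] {Z : ℕ → Set Ω}
    (hZ : ∀ n, MeasurableSet (Z n)) (hmono : Monotone Z) :
    Tendsto (fun n => P.real ((⋃ n, Z n) \ Z n)) atTop (𝓝 0) := by
  have h1 : Tendsto (fun n => P.real (Z n)) atTop (𝓝 (P.real (⋃ n, Z n))) :=
    (ENNReal.tendsto_toReal (measure_ne_top _ _)).comp (tendsto_measure_iUnion_atTop hmono)
  have h2 := h1.const_sub (P.real (⋃ n, Z n))
  rw [sub_self] at h2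
  refine h2.congr fun n => ?_
  rw [measureReal_sdiff (Set.subset_iUnion Z n) (hZ n)]

theorem BoundedOn.iUnion [IsFiniteMeasure P] {A : Set 𝓧} {H : ℕ → Set Ω}
    (hm : ∀ n, MeasurableSet (H n)) (h : ∀ n, BoundedOn P ν A (H n)) :
    BoundedOn P ν A (⋃ n, H n) := by
  intro ε hε
  have hacc : ∀ n, BoundedOn P ν A (Set.accumulate H n) := by
    intro n
    induction n with
    | zero => simpa using h 0
    | succ n ih => rw [Set.accumulate_succ]; exact ih.union (h _)
  have hlim := tendsto_measureReal_iUnion_diff_zero (P := P) (Z := Set.accumulate H)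
    (fun n => MeasurableSet.biUnion (Set.to_countable _) fun i _ => hm i) Set.monotone_accumulate
  rw [Set.iUnion_accumulate] at hlim
  obtain ⟨n, hn⟩ := (hlim.eventually (gt_mem_nhds (show (0 : ℝ) < ε / 2 by positivity))).exists
  obtain ⟨C, hC⟩ := hacc n (ε / 2) (by positivity)
  refine ⟨C, fun B hB hBm => ?_⟩
  have : P.real ((⋃ n, H n) ∩ {ω | C < |ν B ω|}) ≤
      P.real ((⋃ n, H n) \ Set.accumulate H n) + P.real (Set.accumulate H n ∩ {ω | C < |ν B ω|}) := by
    refine measureReal_le_add_of_subset_union ?_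
    rintro ω ⟨hω, hlt⟩
    by_cases h : ω ∈ Set.accumulate H n
    · exact Or.inr ⟨h, hlt⟩
    · exact Or.inl ⟨hω, h⟩
  linarith [hC B hB hBm]

/-- Boundedness survives countable unions of events, so a union of events whose probabilities
approach the supremum is maximal up to null sets. -/
theorem exists_boundedPart [IsFiniteMeasure P] (ν : Set 𝓧 → Ω → ℝ) (A : Set 𝓧) :
    ∃ G, MeasurableSet G ∧ BoundedOn P ν A G ∧
      ∀ H, MeasurableSet H → BoundedOn P ν A H → P.real (H \ G) = 0 := by
  set 𝓢 : Set ℝ := {r | ∃ H, MeasurableSet H ∧ BoundedOn P ν A H ∧ P.real H = r} with h𝓢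
  have hne : 𝓢.Nonempty := ⟨_, ∅, MeasurableSet.empty, fun ε hε => ⟨0, fun B _ _ => by
    simp [hε.le]⟩, rfl⟩
  have hbdd : BddAbove 𝓢 := ⟨P.real Set.univ, by
    rintro _ ⟨H, -, -, rfl⟩
    exact measureReal_mono (Set.subset_univ _) (measure_ne_top _ _)⟩
  obtain ⟨u, -, hu, hmem⟩ := exists_seq_tendsto_sSup hne hbdd
  choose H hm hb hr using hmem
  refine ⟨⋃ n, H n, MeasurableSet.iUnion hm, BoundedOn.iUnion hm hb, fun K hK hKb => ?_⟩
  have h1 : sSup 𝓢 ≤ P.real (⋃ n, H n) := le_of_tendsto' hu fun n => by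
    rw [← hr n]; exact measureReal_mono (Set.subset_iUnion H n) (measure_ne_top _ _)
  have h2 : P.real ((⋃ n, H n) ∪ K) ≤ sSup 𝓢 := le_csSup hbdd
    ⟨_, (MeasurableSet.iUnion hm).union hK, (BoundedOn.iUnion hm hb).union hKb, rfl⟩
  have h3 : P.real ((⋃ n, H n) ∪ K \ ⋃ n, H n) = P.real (⋃ n, H n) + P.real (K \ ⋃ n, H n) :=
    measureReal_union Set.disjoint_sdiff_right (hK.diff (MeasurableSet.iUnion hm))
  rw [Set.union_sdiff_self] at h3
  have := measureReal_nonneg (μ := P) (s := K \ ⋃ n, H n)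
  linarith

/-- The largest event on which the values of `ν` on the subsets of `A` are bounded in
probability. -/
noncomputable def boundedPart (P : Measure Ω) [IsFiniteMeasure P] (ν : Set 𝓧 → Ω → ℝ)
    (A : Set 𝓧) : Set Ω :=
  (exists_boundedPart (P := P) ν A).choose

section boundedPart

variable [IsFiniteMeasure P]

theorem measurableSet_boundedPart (A : Set 𝓧) : MeasurableSet (boundedPart P ν A) :=
  (exists_boundedPart (P := P) ν A).choose_spec.1

theorem boundedOn_boundedPart (A : Set 𝓧) : BoundedOn P ν A (boundedPart P ν A) :=
  (exists_boundedPart (P := P) ν A).choose_spec.2.1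

theorem BoundedOn.measureReal_diff_boundedPart {A : Set 𝓧} {H : Set Ω}
    (h : BoundedOn P ν A H) (hH : MeasurableSet H) : P.real (H \ boundedPart P ν A) = 0 :=
  (exists_boundedPart (P := P) ν A).choose_spec.2.2 H hH h

end boundedPart

namespace IsExhaustiveCharge

theorem measurableSet_lt_abs (hν : IsExhaustiveCharge P ν) (B : Set 𝓧) (C : ℝ) :
    MeasurableSet {ω | C < |ν B ω|} :=
  measurableSet_lt measurable_const (continuous_abs.measurable.comp (hν.measurable B))

theorem empty (hν : IsExhaustiveCharge P ν) : ν ∅ =ᵐ[P] 0 := by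
  filter_upwards [hν.additive ∅ ∅ MeasurableSet.empty MeasurableSet.empty disjoint_bot_left]
    with ω hω
  rw [Set.union_self] at hω
  simpa using hω

theorem sum_cells (hν : IsExhaustiveCharge P ν) {ι : Type*} [DecidableEq ι] {π : 𝓧 → ι}
    (hπ : ∀ i, MeasurableSet (π ⁻¹' {i})) {A : Set 𝓧} (hA : MeasurableSet A) (S : Finset ι) :
    ν (A ∩ π ⁻¹' S) =ᵐ[P] fun ω => ∑ i ∈ S, ν (A ∩ π ⁻¹' {i}) ω := by
  induction S using Finset.induction_on with
  | empty =>
    filter_upwards [hν.empty] with ω hω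
    simpa using hω
  | insert a S ha ih =>
    have e : A ∩ π ⁻¹' (insert a S : Finset ι) = (A ∩ π ⁻¹' {a}) ∪ (A ∩ π ⁻¹' S) := by
      rw [Finset.coe_insert, Set.insert_eq, Set.preimage_union, Set.inter_union_distrib_left]
    have hS : MeasurableSet (π ⁻¹' (S : Set ι)) := by
      have : π ⁻¹' (S : Set ι) = ⋃ i ∈ S, π ⁻¹' {i} := by ext; simp
      rw [this]
      exact S.measurableSet_biUnion fun i _ => hπ i
    have hd : Disjoint (A ∩ π ⁻¹' {a}) (A ∩ π ⁻¹' S) := by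
      refine Set.disjoint_left.2 fun x hx hx' => ha ?_
      have h1 : π x = a := hx.2
      have h2 : π x ∈ S := hx'.2
      rwa [h1] at h2
    rw [e]
    filter_upwards [ih, hν.additive _ _ (hA.inter (hπ a)) (hA.inter hS) hd] with ω h1 h2
    rw [h2, h1, Finset.sum_insert ha]

theorem boundedOn_of_cells [IsFiniteMeasure P] (hν : IsExhaustiveCharge P ν) {ι : Type*}
    [Fintype ι] {π : 𝓧 → ι} (hπ : ∀ i, MeasurableSet (π ⁻¹' {i})) {A : Set 𝓧} {H : Set Ω}
    (h : ∀ i, BoundedOn P ν (A ∩ π ⁻¹' {i}) H) : BoundedOn P ν A H := by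
  classical
  intro ε hε
  choose C hC using fun i => h i (ε / (Fintype.card ι + 1)) (by positivity)
  refine ⟨∑ i, |C i|, fun B hB hBm => ?_⟩
  have hsum := hν.sum_cells hπ hBm Finset.univ
  rw [Finset.coe_univ, Set.preimage_univ, Set.inter_univ] at hsum
  calc P.real (H ∩ {ω | ∑ i, |C i| < |ν B ω|})
      ≤ P.real (⋃ i ∈ (Finset.univ : Finset ι), H ∩ {ω | C i < |ν (B ∩ π ⁻¹' {i}) ω|}) := by
        refine ENNReal.toReal_mono (measure_ne_top _ _) (measure_mono_ae ?_)
        filter_upwards [hsum] with ω hω hmem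
        obtain ⟨hH, hlt⟩ := hmem
        have hlt' : ∑ i, |C i| < |ν B ω| := hlt
        rw [hω] at hlt'
        by_contra hcon
        refine absurd (hlt'.trans_le (Finset.abs_sum_le_sum_abs _ _)) (not_lt.2 ?_)
        refine Finset.sum_le_sum fun i _ => ?_
        by_contra hi
        push Not at hi
        refine hcon ?_
        exact Set.mem_biUnion (Finset.mem_univ i) ⟨hH, lt_of_le_of_lt (le_abs_self _) hi⟩
    _ ≤ ∑ i, P.real (H ∩ {ω | C i < |ν (B ∩ π ⁻¹' {i}) ω|}) := measureReal_biUnion_finset_le _ _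
    _ ≤ ∑ i : ι, ε / (Fintype.card ι + 1) := Finset.sum_le_sum fun i _ =>
        hC i _ (Set.inter_subset_inter_left _ hB) (hBm.inter (hπ i))
    _ ≤ ε := by
        rw [Finset.sum_const, nsmul_eq_mul, Finset.card_univ, ← mul_div_assoc,
          div_le_iff₀ (by positivity)]
        nlinarith

/-- If many cells of a partition carry large values, then so does the union of a random family of
cells. -/
theorem concentration_cells [IsFiniteMeasure P] (hν : IsExhaustiveCharge P ν) {ι : Type*}
    [Fintype ι] [DecidableEq ι] {π : 𝓧 → ι} (hπ : ∀ i, MeasurableSet (π ⁻¹' {i})) {A : Set 𝓧}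
    (hA : MeasurableSet A) {V : Set Ω} (hV : MeasurableSet V) {p : ℝ} (hp0 : 0 ≤ p)
    (hp1 : p ≤ 1 / 2) (C : ℝ) (K : ℕ) :
    (1 - (1 + (1 - 2 * p) ^ K) / 2) *
      P.real (V ∩ {ω | K ≤ (Finset.univ.filter fun i => 2 * C < |ν (A ∩ π ⁻¹' {i}) ω|).card}) ≤
    subsetExp Finset.univ (fun _ => p)
      (fun S : Finset ι => P.real (V ∩ {ω | C < |ν (A ∩ π ⁻¹' (S : Set ι)) ω|})) := by
  have hcard : Measurable fun ω =>
      (Finset.univ.filter fun i => 2 * C < |ν (A ∩ π ⁻¹' {i}) ω|).card := by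
    simp only [Finset.card_filter]
    exact Finset.measurable_sum _ fun i _ =>
      Measurable.ite (hν.measurableSet_lt_abs _ _) measurable_const measurable_const
  refine measureReal_mul_le_subsetExp P (fun S => hV.inter (hν.measurableSet_lt_abs _ _))
    (hV.inter (measurableSet_le measurable_const hcard)) (fun _ => hp0) (fun _ => by linarith) ?_
  have hall : ∀ᵐ ω ∂P, ∀ S : Finset ι,
      ν (A ∩ π ⁻¹' (S : Set ι)) ω = ∑ i ∈ S, ν (A ∩ π ⁻¹' {i}) ω :=
    ae_all_iff.2 fun S => hν.sum_cells hπ hA S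
  filter_upwards [hall] with ω hω hmem
  have hK : K ≤ (Finset.univ.filter fun i => 2 * C < |ν (A ∩ π ⁻¹' {i}) ω|).card := hmem.2
  have hconc := subsetExp_concentration Finset.univ hp0 hp1 (fun i => ν (A ∩ π ⁻¹' {i}) ω) C 0
  have hpow : (1 - 2 * p) ^ (Finset.univ.filter fun i => 2 * C < |ν (A ∩ π ⁻¹' {i}) ω|).card ≤
      (1 - 2 * p) ^ K := pow_le_pow_of_le_one (by linarith) (by linarith) hK
  -- For each selection `S`, either the union of its cells has a large value or the subset sum falls
  -- in the window about `0` whose probability is bounded by `hconc`.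
  have hle : (1 : ℝ) ≤ subsetExp Finset.univ (fun _ => p) (fun S =>
      (V ∩ {ω | C < |ν (A ∩ π ⁻¹' (S : Set ι)) ω|}).indicator 1 ω +
      if |∑ i ∈ S, ν (A ∩ π ⁻¹' {i}) ω - 0| ≤ C then 1 else 0) := by
    rw [← subsetExp_one (Finset.univ : Finset ι) fun _ => p]
    refine subsetExp_mono (fun _ => hp0) (fun _ => by linarith) fun S _ => ?_
    have hnn : 0 ≤ (V ∩ {ω | C < |ν (A ∩ π ⁻¹' (S : Set ι)) ω|}).indicator (1 : Ω → ℝ) ω :=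
      Set.indicator_nonneg (fun _ _ => zero_le_one) _
    split_ifs with h
    · simpa [subsetExp_one] using hnn
    · have : ω ∈ V ∩ {ω | C < |ν (A ∩ π ⁻¹' (S : Set ι)) ω|} := by
        refine ⟨hmem.1, ?_⟩
        show C < _
        rw [hω S]
        simpa using h
      rw [Set.indicator_of_mem this]
      simp
  rw [subsetExp_add] at hle
  linarith

/-- One set does the work of `k`: the `B i` generate at most `2 ^ k` atoms, so a large value on some
`B i` forces an atom above `2 * C`. A uniformly random union of atoms then exceeds `C` with
conditional probability at least `1/2`. -/
theorem exists_union_large [IsFiniteMeasure P] (hν : IsExhaustiveCharge P ν) {A : Set 𝓧}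
    (hA : MeasurableSet A) {V : Set Ω} (hV : MeasurableSet V) {C : ℝ} {k : ℕ}
    (B : Fin k → Set 𝓧) (hB : ∀ i, B i ⊆ A) (hBm : ∀ i, MeasurableSet (B i)) :
    ∃ S ⊆ A, MeasurableSet S ∧
      P.real (V ∩ ⋃ i, {ω | 2 ^ k * (2 * C) < |ν (B i) ω|}) ≤
        2 * P.real (V ∩ {ω | C < |ν S ω|}) := by
  classical
  set π : 𝓧 → (Fin k → Bool) := fun x i => decide (x ∈ B i) with hπdef
  have hπm : Measurable π := measurable_pi_iff.2 fun i => by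
    refine measurable_to_bool ?_
    have : (fun x => decide (x ∈ B i)) ⁻¹' {true} = B i := by ext; simp
    rw [show (fun c => π c i) = fun x => decide (x ∈ B i) from rfl, this]
    exact hBm i
  have hπ : ∀ T, MeasurableSet (π ⁻¹' {T}) := fun T => hπm (measurableSet_singleton T)
  have hconc := hν.concentration_cells hπ hA hV (p := 1 / 2) (by norm_num) le_rfl C 1
  obtain ⟨S, -, hS⟩ := exists_subsetExp_le (s := (Finset.univ : Finset (Fin k → Bool)))
    (p := fun _ => 1 / 2) (fun _ => by norm_num) (fun _ => by norm_num)
    (fun S => P.real (V ∩ {ω | C < |ν (A ∩ π ⁻¹' (S : Set (Fin k → Bool))) ω|}))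
  refine ⟨A ∩ π ⁻¹' S, Set.inter_subset_left,
    hA.inter (hπm (Set.toFinite _).measurableSet), ?_⟩
  have hle : P.real (V ∩ ⋃ i, {ω | 2 ^ k * (2 * C) < |ν (B i) ω|}) ≤
      P.real (V ∩ {ω | 1 ≤ (Finset.univ.filter
        fun T => 2 * C < |ν (A ∩ π ⁻¹' {T}) ω|).card}) := by
    refine ENNReal.toReal_mono (measure_ne_top _ _) (measure_mono_ae ?_)
    have hall : ∀ᵐ ω ∂P, ∀ i : Fin k, ν (B i) ω = ∑ T ∈ Finset.univ.filter fun T => T i = true,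
        ν (A ∩ π ⁻¹' {T}) ω := by
      refine ae_all_iff.2 fun i => ?_
      have h1 := hν.sum_cells hπ hA (Finset.univ.filter fun T => T i = true)
      have e : A ∩ π ⁻¹' ((Finset.univ.filter fun T : Fin k → Bool => T i = true) :
          Finset (Fin k → Bool)) = B i := by
        ext x
        simp only [hπdef, Finset.coe_filter, Finset.mem_univ, true_and, Set.mem_inter_iff,
          Set.mem_preimage, Set.mem_ofPred_eq, decide_eq_true_eq]
        exact ⟨fun h => h.2, fun h => ⟨hB i h, h⟩⟩
      rwa [e] at h1
    filter_upwards [hall] with ω hω hmem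
    refine ⟨hmem.1, ?_⟩
    show 1 ≤ _
    obtain ⟨i, hi⟩ := Set.mem_iUnion.1 hmem.2
    have hi' : 2 ^ k * (2 * C) < |ν (B i) ω| := hi
    by_contra hcon
    have h0 : ∀ T, |ν (A ∩ π ⁻¹' {T}) ω| ≤ 2 * C := by
      intro T
      by_contra hT
      refine hcon (Finset.card_pos.2 ⟨T, ?_⟩)
      simpa using hT
    rw [hω i] at hi'
    refine absurd hi' (not_lt.2 ((Finset.abs_sum_le_sum_abs _ _).trans ?_))
    calc ∑ T ∈ Finset.univ.filter (fun T : Fin k → Bool => T i = true), |ν (A ∩ π ⁻¹' {T}) ω|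
        ≤ ∑ T : Fin k → Bool, |ν (A ∩ π ⁻¹' {T}) ω| :=
          Finset.sum_le_sum_of_subset_of_nonneg (Finset.filter_subset _ _)
            fun _ _ _ => abs_nonneg _
      _ ≤ ∑ T : Fin k → Bool, 2 * C := Finset.sum_le_sum fun T _ => h0 T
      _ = 2 ^ k * (2 * C) := by simp
  rw [show (1 - (1 + (1 - 2 * (1 / 2 : ℝ)) ^ 1) / 2) = 1 / 2 by norm_num] at hconc
  linarith [hconc.trans hS]

/-- Greedy choice: otherwise, as long as the exceptional event has probability at most `q`, a
further set exceeds `C` on more than `1 / k` of what remains of `V`. After `k` choices the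
exceptional event has probability at least `1 > q`. -/
theorem exists_remainder [IsProbabilityMeasure P] (hν : IsExhaustiveCharge P ν) {A : Set 𝓧}
    {V : Set Ω} (hV : MeasurableSet V) {q C : ℝ} (hq : q < 1) {k : ℕ} (hk : 0 < k)
    (h : ∀ B : Fin k → Set 𝓧, (∀ i, B i ⊆ A) → (∀ i, MeasurableSet (B i)) →
      P.real (V ∩ ⋃ i, {ω | C < |ν (B i) ω|}) ≤ q) :
    ∃ G ⊆ V, MeasurableSet G ∧ P.real V - q ≤ P.real G ∧
      ∀ B ⊆ A, MeasurableSet B → P.real (G ∩ {ω | C < |ν B ω|}) ≤ 1 / k := by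
  by_contra hcon
  push Not at hcon
  have hkr : (0 : ℝ) < k := by exact_mod_cast hk
  have hpart : ∀ B : ℕ → Set 𝓧, (∀ i, B i ⊆ A) → (∀ i, MeasurableSet (B i)) → ∀ j ≤ k,
      P.real (V ∩ ⋃ i ∈ Finset.range j, {ω | C < |ν (B i) ω|}) ≤ q := by
    intro B hB hBm j hj
    refine (measureReal_mono (Set.inter_subset_inter_right _ ?_) (measure_ne_top _ _)).trans
      (h (fun i => B i) (fun i => hB i) (fun i => hBm i))
    refine Set.iUnion₂_subset fun i hi => ?_
    exact Set.subset_iUnion (fun i : Fin k => {ω | C < |ν (B i) ω|})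
      ⟨i, (Finset.mem_range.1 hi).trans_le hj⟩
  have main : ∀ j ≤ k, ∃ B : ℕ → Set 𝓧, (∀ i, B i ⊆ A) ∧ (∀ i, MeasurableSet (B i)) ∧
      (j : ℝ) / k ≤ P.real (V ∩ ⋃ i ∈ Finset.range j, {ω | C < |ν (B i) ω|}) := by
    intro j
    induction j with
    | zero => exact fun _ => ⟨fun _ => ∅, fun _ => Set.empty_subset _, fun _ => .empty, by simp⟩
    | succ j ih =>
      intro hj
      obtain ⟨B, hB, hBm, hle⟩ := ih (by omega)
      have hUm : MeasurableSet (⋃ i ∈ Finset.range j, {ω | C < |ν (B i) ω|}) :=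
        (Finset.range j).measurableSet_biUnion fun i _ => hν.measurableSet_lt_abs _ _
      set W := ⋃ i ∈ Finset.range j, {ω | C < |ν (B i) ω|} with hW
      have hVW : P.real V = P.real (V ∩ W) + P.real (V \ W) :=
        (measureReal_inter_add_sdiff hUm).symm
      obtain ⟨B', hB', hBm', hlt⟩ := hcon (V \ W) Set.sdiff_subset (hV.diff hUm)
        (by linarith [hpart B hB hBm j (by omega)])
      refine ⟨Function.update B j B', fun i => ?_, fun i => ?_, ?_⟩
      · by_cases hi : i = j
        · subst hi; simpa using hB'
        · simpa [hi] using hB i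
      · by_cases hi : i = j
        · subst hi; simpa using hBm'
        · simpa [hi] using hBm i
      · have e : ⋃ i ∈ Finset.range (j + 1), {ω | C < |ν (Function.update B j B' i) ω|} =
            W ∪ {ω | C < |ν B' ω|} := by
          rw [Finset.range_add_one, Finset.set_biUnion_insert, Set.union_comm]
          congr 1
          · refine Set.iUnion₂_congr fun i hi => ?_
            rw [Function.update_of_ne (Finset.mem_range.1 hi).ne]
          · simp
        rw [e]
        have hsub : (V ∩ W) ∪ ((V \ W) ∩ {ω | C < |ν B' ω|}) ⊆ V ∩ (W ∪ {ω | C < |ν B' ω|}) := by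
          rintro ω (⟨h1, h2⟩ | ⟨⟨h1, -⟩, h2⟩)
          · exact ⟨h1, Or.inl h2⟩
          · exact ⟨h1, Or.inr h2⟩
        have hu := measureReal_mono (μ := P) hsub (measure_ne_top _ _)
        rw [measureReal_union (Set.disjoint_left.2 fun ω h1 h2 => h2.1.2 h1.2)
          ((hV.diff hUm).inter (hν.measurableSet_lt_abs _ _))] at hu
        push_cast
        rw [add_div]
        linarith
  obtain ⟨B, hB, hBm, hle⟩ := main k le_rfl
  rw [div_self hkr.ne'] at hle
  linarith [hpart B hB hBm k le_rfl]

end IsExhaustiveCharge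

/-- The event sought is the upper limit of the `G n`, which keeps the lower bound on the
probability. Up to small probability it is covered by finitely many `G n` with `n ≥ N`, whose errors
sum to at most `2 * (1/2) ^ N`. -/
theorem exists_boundedOn_of_approx [IsFiniteMeasure P] {A : Set 𝓧} {V : Set Ω} {q : ℝ}
    (h : ∀ n : ℕ, ∃ C : ℝ, ∃ G ⊆ V, MeasurableSet G ∧ P.real V - q ≤ P.real G ∧
      ∀ B ⊆ A, MeasurableSet B → P.real (G ∩ {ω | C < |ν B ω|}) ≤ (1 / 2) ^ n) :
    ∃ G ⊆ V, MeasurableSet G ∧ P.real V - q ≤ P.real G ∧ BoundedOn P ν A G := by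
  choose C G hGV hGm hGq hGB using h
  set W : ℕ → Set Ω := fun N => ⋃ n ∈ Set.Ici N, G n with hW
  have hWm : ∀ N, MeasurableSet (W N) := fun N =>
    MeasurableSet.biUnion (Set.to_countable _) fun n _ => hGm n
  refine ⟨⋂ N, W N, ?_, MeasurableSet.iInter hWm, ?_, ?_⟩
  · exact (Set.iInter_subset W 0).trans (Set.iUnion₂_subset fun n _ => hGV n)
  · have hanti : Antitone W := fun a b hab =>
      Set.biUnion_subset_biUnion_left fun n hn => le_trans hab hn
    have hlim : Tendsto (fun N => P.real (W N)) atTop (𝓝 (P.real (⋂ N, W N))) :=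
      (ENNReal.tendsto_toReal (measure_ne_top _ _)).comp
        (tendsto_measure_iInter_atTop (fun N => (hWm N).nullMeasurableSet) hanti
          ⟨0, measure_ne_top _ _⟩)
    refine ge_of_tendsto' hlim fun N => (hGq N).trans
      (measureReal_mono ?_ (measure_ne_top _ _))
    exact Set.subset_biUnion_of_mem (u := G) (Set.mem_Ici.2 (le_refl N))
  · intro ε hε
    obtain ⟨N, hN⟩ := exists_pow_lt_of_lt_one (show (0 : ℝ) < ε / 4 by positivity)
      (show (1 / 2 : ℝ) < 1 by norm_num)
    set Z : ℕ → Set Ω := fun M => ⋃ n ∈ Finset.Ico N M, G n with hZ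
    have hZm : ∀ M, MeasurableSet (Z M) := fun M =>
      (Finset.Ico N M).measurableSet_biUnion fun n _ => hGm n
    have hZmono : Monotone Z := fun a b hab =>
      Set.biUnion_subset_biUnion_left fun n hn => by
        have := Finset.mem_Ico.1 hn
        exact Finset.mem_Ico.2 ⟨this.1, this.2.trans_le hab⟩
    have hZW : ⋃ M, Z M = W N := by
      ext ω
      simp only [hZ, hW, Set.mem_iUnion, Finset.mem_Ico, Set.mem_Ici, exists_prop]
      exact ⟨fun ⟨M, n, hn, hω⟩ => ⟨n, hn.1, hω⟩,
        fun ⟨n, hn, hω⟩ => ⟨n + 1, n, ⟨hn, Nat.lt_succ_self n⟩, hω⟩⟩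
    have hlim := tendsto_measureReal_iUnion_diff_zero (P := P) hZm hZmono
    rw [hZW] at hlim
    obtain ⟨M, hM⟩ := (hlim.eventually (gt_mem_nhds (show (0 : ℝ) < ε / 2 by positivity))).exists
    refine ⟨∑ n ∈ Finset.Ico N M, |C n|, fun B hB hBm => ?_⟩
    have hsub : (⋂ N, W N) ∩ {ω | ∑ n ∈ Finset.Ico N M, |C n| < |ν B ω|} ⊆
        (W N \ Z M) ∪ ⋃ n ∈ Finset.Ico N M, G n ∩ {ω | C n < |ν B ω|} := by
      rintro ω ⟨hω, hlt⟩
      by_cases hZω : ω ∈ Z M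
      · right
        simp only [hZ, Set.mem_iUnion, exists_prop] at hZω ⊢
        obtain ⟨n, hn, hωn⟩ := hZω
        refine ⟨n, hn, hωn, show C n < |ν B ω| from lt_of_le_of_lt ?_ hlt⟩
        exact (le_abs_self _).trans
          (Finset.single_le_sum (f := fun n => |C n|) (fun _ _ => abs_nonneg _) hn)
      · exact Or.inl ⟨Set.mem_iInter.1 hω N, hZω⟩
    have h1 := measureReal_le_add_of_subset_union (P := P) hsub
    have h2 : P.real (⋃ n ∈ Finset.Ico N M, G n ∩ {ω | C n < |ν B ω|}) ≤ ε / 2 := by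
      calc _ ≤ ∑ n ∈ Finset.Ico N M, P.real (G n ∩ {ω | C n < |ν B ω|}) :=
            measureReal_biUnion_finset_le _ _
        _ ≤ ∑ n ∈ Finset.Ico N M, (1 / 2 : ℝ) ^ n := Finset.sum_le_sum fun n _ => hGB n B hB hBm
        _ ≤ (1 / 2 : ℝ) ^ N / (1 - 1 / 2) :=
            geom_sum_Ico_le_of_lt_one (by norm_num) (by norm_num)
        _ = 2 * (1 / 2 : ℝ) ^ N := by ring
        _ ≤ ε / 2 := by linarith
    linarith

end Charge

/-! ### Talagrand's theorem: the range of an exhaustive charge is bounded in probability. -/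

section Talagrand

variable {𝓧 : Type*} [MeasurableSpace 𝓧] {Ω : Type*} [MeasurableSpace Ω]
  {P : Measure Ω} {ν : Set 𝓧 → Ω → ℝ}

theorem IsExhaustiveCharge.measurable_card_large (hν : IsExhaustiveCharge P ν) {ι : Type*} [Fintype ι]
    (D : ι → Set 𝓧) (C : ℝ) :
    Measurable fun ω => (Finset.univ.filter fun i => C < |ν (D i) ω|).card := by
  simp only [Finset.card_filter]
  exact Finset.measurable_sum _ fun i _ =>
    Measurable.ite (hν.measurableSet_lt_abs _ _) measurable_const measurable_const

variable [IsProbabilityMeasure P]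

theorem measureReal_eq_zero_of_diff {A B : Set Ω} (h : P.real (A \ B) = 0)
    (h' : P.real (A ∩ B) = 0) : P.real A = 0 := by
  have : A ⊆ (A \ B) ∪ (A ∩ B) := by rw [Set.sdiff_union_inter]
  have := measureReal_le_add_of_subset_union (P := P) this
  exact le_antisymm (by linarith) measureReal_nonneg

namespace IsExhaustiveCharge

/-- If no single subset were large on a quarter of `V`, no finite family could be large, at a
correspondingly higher level, on half of it (`exists_union_large`). Then `exists_remainder`, with `k
= 2 ^ n`, yields a bounded event filling half of `V`, although `V` misses the bounded part. -/
theorem exists_large_subset (hν : IsExhaustiveCharge P ν) {A : Set 𝓧} (hA : MeasurableSet A)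
    {V : Set Ω} (hV : MeasurableSet V) (hVA : P.real (V ∩ boundedPart P ν A) = 0) (C : ℝ) :
    ∃ B ⊆ A, MeasurableSet B ∧ P.real V / 4 ≤ P.real (V ∩ {ω | C < |ν B ω|}) := by
  by_contra hcon
  push Not at hcon
  have hpos : 0 < P.real V := by
    have := measureReal_nonneg.trans_lt (hcon ∅ (Set.empty_subset _) .empty)
    linarith
  obtain ⟨G, hGV, hGm, hGq, hGb⟩ := exists_boundedOn_of_approx (P := P) (ν := ν) (A := A)
    (V := V) (q := P.real V / 2) fun n => by
      obtain ⟨G, hGV, hGm, hGq, hGb⟩ := hν.exists_remainder (A := A) hV (q := P.real V / 2)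
        (C := 2 ^ (2 ^ n) * (2 * C)) (by linarith [measureReal_le_one (μ := P) (s := V)])
        (k := 2 ^ n) (by positivity) fun B hB hBm => by
          obtain ⟨S, hS, hSm, hle⟩ := hν.exists_union_large hA hV B hB hBm
          linarith [hcon S hS hSm]
      refine ⟨_, G, hGV, hGm, hGq, fun B hB hBm => (hGb B hB hBm).trans (le_of_eq ?_)⟩
      push_cast
      rw [one_div_pow]
  have h0 : P.real G = 0 := measureReal_eq_zero_of_diff (hGb.measureReal_diff_boundedPart hGm)
    (le_antisymm ((measureReal_mono (Set.inter_subset_inter_left _ hGV)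
      (measure_ne_top _ _)).trans_eq hVA) measureReal_nonneg)
  linarith

/-- Off a small event `|ν A| ≤ M`, so a value of `ν B` beyond `C + M` forces `ν (A \ B)` beyond `C`.
The price is half of the quarter from `exists_large_subset`. -/
theorem exists_split (hν : IsExhaustiveCharge P ν) {A : Set 𝓧} (hA : MeasurableSet A)
    {V : Set Ω} (hV : MeasurableSet V) (hVA : P.real (V ∩ boundedPart P ν A) = 0) (C : ℝ) :
    ∃ B ⊆ A, MeasurableSet B ∧
      P.real V / 8 ≤ P.real (V ∩ {ω | C < |ν B ω| ∧ C < |ν (A \ B) ω|}) := by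
  rcases (measureReal_nonneg (μ := P) (s := V)).eq_or_lt with h0 | hpos
  · exact ⟨∅, Set.empty_subset _, .empty, by rw [← h0]; simp⟩
  obtain ⟨M, hM, hM0⟩ := (((tendsto_measureReal_lt_atTop P
    (continuous_abs.measurable.comp (hν.measurable A))).eventually
      (gt_mem_nhds (show 0 < P.real V / 8 by positivity))).and (eventually_ge_atTop 0)).exists
  obtain ⟨B, hBA, hBm, hle⟩ := hν.exists_large_subset hA hV hVA (C + M)
  refine ⟨B, hBA, hBm, ?_⟩
  have hadd := hν.additive B (A \ B) hBm (hA.diff hBm) Set.disjoint_sdiff_right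
  rw [Set.union_sdiff_cancel hBA] at hadd
  have : P.real (V ∩ {ω | C + M < |ν B ω|}) ≤
      P.real ((V ∩ {ω | C < |ν B ω| ∧ C < |ν (A \ B) ω|}) ∪ {ω | M < |ν A ω|}) := by
    refine ENNReal.toReal_mono (measure_ne_top _ _) (measure_mono_ae ?_)
    filter_upwards [hadd] with ω hω hmem
    have h1 : C + M < |ν B ω| := hmem.2
    by_cases h : M < |ν A ω|
    · exact Or.inr h
    · push Not at h
      refine Or.inl ⟨hmem.1, show C < |ν B ω| by linarith, show C < |ν (A \ B) ω| from ?_⟩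
      have : |ν B ω| ≤ |ν A ω| + |ν (A \ B) ω| := by
        rw [show ν B ω = ν A ω - ν (A \ B) ω by linarith]
        exact abs_sub _ _
      linarith
  have h2 := measureReal_union_le (μ := P) (V ∩ {ω | C < |ν B ω| ∧ C < |ν (A \ B) ω|})
    {ω | M < |ν A ω|}
  have hM' : P.real {ω | M < |ν A ω|} < P.real V / 8 := hM
  linarith

/-- Almost every `ω ∈ V` lies outside the bounded part of some cell. Each cell is split to serve the
`ω` for which it is unbounded, and the remaining `ω` are left to the other cells, so the fraction
`1/8` is not diluted. -/
theorem exists_split_cells (hν : IsExhaustiveCharge P ν) {ι : Type*} [DecidableEq ι]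
    {D : ι → Set 𝓧} (hD : ∀ i, MeasurableSet (D i)) (C : ℝ) (s : Finset ι)
    {V : Set Ω} (hV : MeasurableSet V)
    (hVD : P.real (V ∩ ⋂ i ∈ s, boundedPart P ν (D i)) = 0) :
    ∃ B : ι → Set 𝓧, (∀ i, B i ⊆ D i) ∧ (∀ i, MeasurableSet (B i)) ∧
      P.real V / 8 ≤ P.real (V ∩ ⋃ i ∈ s, {ω | C < |ν (B i) ω| ∧ C < |ν (D i \ B i) ω|}) := by
  induction s using Finset.induction_on generalizing V with
  | empty =>
    refine ⟨fun _ => ∅, fun _ => Set.empty_subset _, fun _ => .empty, ?_⟩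
    have : P.real V = 0 := by simpa using hVD
    rw [this]; simp
  | insert a s ha ih =>
    have hbm := measurableSet_boundedPart (P := P) (ν := ν) (D a)
    obtain ⟨B, hB, hBm, hle⟩ := ih (V := V ∩ boundedPart P ν (D a)) (hV.inter hbm) (by
      rwa [Finset.set_biInter_insert, ← Set.inter_assoc] at hVD)
    obtain ⟨B', hB', hBm', hle'⟩ := hν.exists_split (hD a) (V := V \ boundedPart P ν (D a))
      (hV.diff hbm) (by rw [Set.sdiff_inter_self]; simp) C
    refine ⟨Function.update B a B', fun i => ?_, fun i => ?_, ?_⟩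
    · by_cases hi : i = a
      · subst hi; simpa using hB'
      · simpa [hi] using hB i
    · by_cases hi : i = a
      · subst hi; simpa using hBm'
      · simpa [hi] using hBm i
    · have e : ⋃ i ∈ s, {ω | C < |ν (Function.update B a B' i) ω| ∧
          C < |ν (D i \ Function.update B a B' i) ω|} =
          ⋃ i ∈ s, {ω | C < |ν (B i) ω| ∧ C < |ν (D i \ B i) ω|} := by
        refine Set.iUnion₂_congr fun i hi => ?_
        rw [Function.update_of_ne (show i ≠ a from fun h => ha (h ▸ hi))]
      rw [Finset.set_biUnion_insert, e, Function.update_self]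
      set E := ⋃ i ∈ s, {ω | C < |ν (B i) ω| ∧ C < |ν (D i \ B i) ω|}
      set E' := {ω | C < |ν B' ω| ∧ C < |ν (D a \ B') ω|} with hE'
      have hE'm : MeasurableSet E' :=
        (hν.measurableSet_lt_abs _ _).inter (hν.measurableSet_lt_abs _ _)
      have hsub : (V ∩ boundedPart P ν (D a) ∩ E) ∪ ((V \ boundedPart P ν (D a)) ∩ E') ⊆
          V ∩ (E' ∪ E) := by
        rintro ω (⟨⟨h1, -⟩, h2⟩ | ⟨⟨h1, -⟩, h2⟩)
        · exact ⟨h1, Or.inr h2⟩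
        · exact ⟨h1, Or.inl h2⟩
      have hu := measureReal_mono (μ := P) hsub (measure_ne_top _ _)
      rw [measureReal_union (Set.disjoint_left.2 fun ω h1 h2 => h2.1.2 h1.1.2)
        ((hV.diff hbm).inter hE'm)] at hu
      have hVs := measureReal_inter_add_sdiff (μ := P) (s := V) hbm
      linarith

theorem measureReal_iInter_boundedPart (hν : IsExhaustiveCharge P ν) {ι : Type*} [Fintype ι]
    {π : 𝓧 → ι} (hπ : ∀ i, MeasurableSet (π ⁻¹' {i})) (A : Set 𝓧) :
    P.real ((⋂ i, boundedPart P ν (A ∩ π ⁻¹' {i})) \ boundedPart P ν A) = 0 := by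
  refine BoundedOn.measureReal_diff_boundedPart (hν.boundedOn_of_cells hπ fun i =>
    (boundedOn_boundedPart _).mono le_rfl (Set.iInter_subset _ i)) ?_
  exact MeasurableSet.iInter fun i => measurableSet_boundedPart _

theorem integrable_min_card (hν : IsExhaustiveCharge P ν) {ι : Type*} [Fintype ι]
    (D : ι → Set 𝓧) (C : ℝ) (R : ℕ) (U : Set Ω) :
    Integrable (fun ω => ((min (Finset.univ.filter fun i => C < |ν (D i) ω|).card R : ℕ) : ℝ))
      (P.restrict U) := by
  refine Integrable.of_bound (C := R) ?_ (Eventually.of_forall fun ω => ?_)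
  · exact (measurable_from_top.comp
      ((hν.measurable_card_large D C).min measurable_const)).aestronglyMeasurable
  · rw [Real.norm_of_nonneg (Nat.cast_nonneg _)]
    exact_mod_cast min_le_right _ _

/-- Each refinement raises the mean truncated number of large cells by an eighth of the mass. A cell
above `2 * C` leaves at least one half above `C`, and on an eighth of the unbounded event some cell
has both halves above `C`. The level is halved each time, hence the induction for all `C`. -/
theorem exists_partition_card (hν : IsExhaustiveCharge P ν) {A : Set 𝓧} (hA : MeasurableSet A)
    (R : ℕ) (C : ℝ) :
    ∃ (ι : Type) (_ : Fintype ι) (π : 𝓧 → ι), (∀ i, MeasurableSet (π ⁻¹' {i})) ∧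
      R * (P.real (boundedPart P ν A)ᶜ / 8) ≤ ∫ ω in (boundedPart P ν A)ᶜ,
        ((min (Finset.univ.filter fun i => C < |ν (A ∩ π ⁻¹' {i}) ω|).card R : ℕ) : ℝ) ∂P := by
  classical
  induction R generalizing C with
  | zero =>
    refine ⟨Unit, inferInstance, fun _ => (), fun i => ?_, by simp⟩
    exact measurable_const (measurableSet_singleton i)
  | succ R ih =>
    obtain ⟨ι, _, π, hπ, hle⟩ := ih (2 * C)
    have hUm : MeasurableSet (boundedPart P ν A)ᶜ := (measurableSet_boundedPart A).compl
    set U := (boundedPart P ν A)ᶜ with hU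
    have hD : ∀ i, MeasurableSet (A ∩ π ⁻¹' {i}) := fun i => hA.inter (hπ i)
    obtain ⟨B, hB, hBm, hBle⟩ := hν.exists_split_cells hD C Finset.univ hUm (by
      have := hν.measureReal_iInter_boundedPart hπ A
      rw [Set.sdiff_eq, Set.inter_comm] at this
      simpa using this)
    set E := ⋃ i ∈ (Finset.univ : Finset ι),
      {ω | C < |ν (B i) ω| ∧ C < |ν ((A ∩ π ⁻¹' {i}) \ B i) ω|} with hE
    have hEm : MeasurableSet E := Finset.univ.measurableSet_biUnion fun i _ =>
      (hν.measurableSet_lt_abs _ _).inter (hν.measurableSet_lt_abs _ _)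
    set π' : 𝓧 → ι × Bool := fun x => (π x, decide (x ∈ B (π x))) with hπ'
    have hcell_true : ∀ i, A ∩ π' ⁻¹' {(i, true)} = B i := by
      intro i; ext x
      simp only [hπ', Set.mem_inter_iff, Set.mem_preimage, Set.mem_singleton_iff, Prod.mk.injEq,
        decide_eq_true_eq]
      constructor
      · rintro ⟨-, rfl, h⟩; exact h
      · intro h
        have h2 := hB i h
        have h3 : π x = i := h2.2
        exact ⟨h2.1, h3, h3 ▸ h⟩
    have hcell_false : ∀ i, A ∩ π' ⁻¹' {(i, false)} = (A ∩ π ⁻¹' {i}) \ B i := by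
      intro i; ext x
      simp only [hπ', Set.mem_inter_iff, Set.mem_preimage, Set.mem_singleton_iff, Prod.mk.injEq,
        decide_eq_false_iff_not, Set.mem_sdiff]
      constructor
      · rintro ⟨h1, rfl, h⟩; exact ⟨⟨h1, rfl⟩, h⟩
      · rintro ⟨⟨h1, rfl⟩, h⟩; exact ⟨h1, rfl, h⟩
    refine ⟨ι × Bool, inferInstance, π', ?_, ?_⟩
    · rintro ⟨i, b⟩
      have hb : π' ⁻¹' {(i, b)} = π ⁻¹' {i} ∩ if b then B i else (B i)ᶜ := by
        ext x
        cases b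
        · simp only [hπ', Set.mem_preimage, Set.mem_singleton_iff, Prod.mk.injEq,
            decide_eq_false_iff_not, Set.mem_inter_iff]
          constructor
          · rintro ⟨rfl, h⟩; exact ⟨rfl, h⟩
          · rintro ⟨rfl, h⟩; exact ⟨rfl, h⟩
        · simp only [hπ', Set.mem_preimage, Set.mem_singleton_iff, Prod.mk.injEq,
            decide_eq_true_eq, Set.mem_inter_iff]
          constructor
          · rintro ⟨rfl, h⟩; exact ⟨rfl, h⟩
          · rintro ⟨rfl, h⟩; exact ⟨rfl, h⟩
      rw [hb]
      refine (hπ i).inter ?_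
      split_ifs
      · exact hBm i
      · exact (hBm i).compl
    · have hEint : ∫ ω in U, E.indicator (1 : Ω → ℝ) ω ∂P = P.real (U ∩ E) := by
        rw [integral_indicator_one hEm, measureReal_restrict_apply hEm, Set.inter_comm]
      have hEi : Integrable (E.indicator (1 : Ω → ℝ)) (P.restrict U) :=
        (integrable_const (1 : ℝ)).indicator hEm
      have hadd : ∀ᵐ ω ∂P, ∀ i, ν (A ∩ π ⁻¹' {i}) ω =
          ν (B i) ω + ν ((A ∩ π ⁻¹' {i}) \ B i) ω := by
        refine ae_all_iff.2 fun i => ?_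
        have := hν.additive _ _ (hBm i) ((hD i).diff (hBm i)) Set.disjoint_sdiff_right
        rwa [Set.union_sdiff_cancel (hB i)] at this
      calc ((R + 1 : ℕ) : ℝ) * (P.real U / 8) = R * (P.real U / 8) + P.real U / 8 := by
            push_cast; ring
        _ ≤ (∫ ω in U, ((min (Finset.univ.filter
              fun i => 2 * C < |ν (A ∩ π ⁻¹' {i}) ω|).card R : ℕ) : ℝ) ∂P) + P.real (U ∩ E) :=
            add_le_add hle hBle
        _ = ∫ ω in U, (((min (Finset.univ.filter
              fun i => 2 * C < |ν (A ∩ π ⁻¹' {i}) ω|).card R : ℕ) : ℝ) +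
                E.indicator (1 : Ω → ℝ) ω) ∂P := by
            rw [integral_add (hν.integrable_min_card (fun i => A ∩ π ⁻¹' {i}) (2 * C) R U) hEi,
              hEint]
        _ ≤ _ := by
            refine integral_mono_ae
              ((hν.integrable_min_card (fun i => A ∩ π ⁻¹' {i}) (2 * C) R U).add hEi)
              (hν.integrable_min_card (fun j => A ∩ π' ⁻¹' {j}) C (R + 1) U)
              (ae_restrict_of_ae ?_)
            filter_upwards [hadd] with ω hω
            set a : ι → ℕ := fun i => if 2 * C < |ν (A ∩ π ⁻¹' {i}) ω| then 1 else 0 with ha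
            set b : ι → ℕ := fun i => (if C < |ν (B i) ω| then 1 else 0) +
              (if C < |ν ((A ∩ π ⁻¹' {i}) \ B i) ω| then 1 else 0) with hb
            have hab : ∀ i, a i ≤ b i := by
              intro i
              simp only [ha, hb]
              split_ifs with h1 h2 h3 <;> try omega
              have := abs_add_le (ν (B i) ω) (ν ((A ∩ π ⁻¹' {i}) \ B i) ω)
              rw [← hω i] at this
              linarith
            have hca : (Finset.univ.filter fun i => 2 * C < |ν (A ∩ π ⁻¹' {i}) ω|).card =
                ∑ i, a i := by rw [Finset.card_filter]
            have hcb : (Finset.univ.filter fun j => C < |ν (A ∩ π' ⁻¹' {j}) ω|).card =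
                ∑ i, b i := by
              rw [Finset.card_filter, Fintype.sum_prod_type]
              refine Finset.sum_congr rfl fun i _ => ?_
              rw [Fintype.sum_bool, hcell_true, hcell_false]
            rw [hca, hcb]
            have hsum : ∑ i, a i ≤ ∑ i, b i := Finset.sum_le_sum fun i _ => hab i
            -- The split cell had count at most `1` before and has count `2` after; raising the cap
            -- from `R` to `R + 1` keeps this gain under truncation.
            by_cases hωE : ω ∈ E
            · have hlt : ∑ i, a i < ∑ i, b i := by
                simp only [hE, Set.mem_iUnion, exists_prop] at hωE
                obtain ⟨i, -, h1, h2⟩ := hωE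
                refine Finset.sum_lt_sum (fun i _ => hab i) ⟨i, Finset.mem_univ i, ?_⟩
                simp only [ha, hb, if_pos h1, if_pos h2]
                split_ifs <;> norm_num
              rw [Set.indicator_of_mem hωE, Pi.one_apply]
              have : min (∑ i, a i) R + 1 ≤ min (∑ i, b i) (R + 1) := by omega
              exact_mod_cast this
            · rw [Set.indicator_of_notMem hωE, add_zero]
              have : min (∑ i, a i) R ≤ min (∑ i, b i) (R + 1) := by omega
              exact_mod_cast this

/-- The set is a sparse random union of cells of a partition with many large cells. Numerous large
cells make the union large even at small density `p`, while a cell on which `ν` is unbounded at `ω`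
is left in the complement with probability `1 - p`. -/
theorem exists_large_subset_complement (hν : IsExhaustiveCharge P ν) {A : Set 𝓧}
    (hA : MeasurableSet A) (hpos : 0 < P.real (boundedPart P ν A)ᶜ) {δ : ℝ} (hδ : 0 < δ) :
    ∃ B ⊆ A, MeasurableSet B ∧ P.real (boundedPart P ν A)ᶜ / 128 ≤ P.real {ω | 1 < |ν B ω|} ∧
      P.real (boundedPart P ν A)ᶜ - δ ≤ P.real (boundedPart P ν (A \ B))ᶜ := by
  classical
  have hUm : MeasurableSet (boundedPart P ν A)ᶜ := (measurableSet_boundedPart A).compl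
  have hu1 : P.real (boundedPart P ν A)ᶜ ≤ 1 := measureReal_le_one
  set U := (boundedPart P ν A)ᶜ with hU
  set u := P.real U with hu
  set p : ℝ := min (1 / 2) (δ / 128) with hp
  have hp0 : 0 < p := lt_min (by norm_num) (by positivity)
  have hp1 : p ≤ 1 / 2 := min_le_left _ _
  have hpδ : p ≤ δ / 128 := min_le_right _ _
  obtain ⟨K, hK⟩ := exists_pow_lt_of_lt_one (show (0 : ℝ) < 1 / 2 by norm_num)
    (show 1 - 2 * p < 1 by linarith)
  have hK0 : K ≠ 0 := by rintro rfl; norm_num at hK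
  have hKr : (0 : ℝ) < K := by exact_mod_cast Nat.pos_of_ne_zero hK0
  obtain ⟨ι, _, π, hπ, hle⟩ := hν.exists_partition_card hA (16 * K) (2 * 1)
  have hN : MeasurableSet {ω | K ≤ (Finset.univ.filter
      fun i => 2 * 1 < |ν (A ∩ π ⁻¹' {i}) ω|).card} :=
    measurableSet_le measurable_const (hν.measurable_card_large (fun i => A ∩ π ⁻¹' {i}) (2 * 1))
  set N := {ω | K ≤ (Finset.univ.filter fun i => 2 * 1 < |ν (A ∩ π ⁻¹' {i}) ω|).card} with hNdef
  -- The truncated count has integral at least `16 * K * u / 8 = 2 * K * u` over `U`, and it is at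
  -- most `K + 16 * K` on `N` and at most `K` off `N`.
  have hN16 : u / 16 ≤ P.real (U ∩ N) := by
    have hNi : Integrable (N.indicator (1 : Ω → ℝ)) (P.restrict U) :=
      (integrable_const (1 : ℝ)).indicator hN
    have hmin : ∀ n : ℕ, ((min n (16 * K) : ℕ) : ℝ) ≤ K + 16 * K := fun n => by
      exact_mod_cast (show min n (16 * K) ≤ K + 16 * K by omega)
    have h1 : ∫ ω in U, ((min (Finset.univ.filter
        fun i => 2 * 1 < |ν (A ∩ π ⁻¹' {i}) ω|).card (16 * K) : ℕ) : ℝ) ∂P ≤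
        ∫ ω in U, ((K : ℝ) + 16 * K * N.indicator (1 : Ω → ℝ) ω) ∂P := by
      refine integral_mono (hν.integrable_min_card (fun i => A ∩ π ⁻¹' {i}) (2 * 1) (16 * K) U)
        ((integrable_const _).add (hNi.const_mul _)) fun ω => ?_
      by_cases hω : ω ∈ N
      · simp only [Set.indicator_of_mem hω, Pi.one_apply]
        exact (hmin _).trans_eq (by ring)
      · simp only [Set.indicator_of_notMem hω, mul_zero, add_zero]
        have h2 : ¬ K ≤ (Finset.univ.filter fun i => 2 * 1 < |ν (A ∩ π ⁻¹' {i}) ω|).card := hω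
        exact_mod_cast (min_le_left _ _).trans (not_le.1 h2).le
    rw [integral_add (integrable_const _) (hNi.const_mul _),
      integral_const, integral_const_mul, integral_indicator_one hN,
      measureReal_restrict_apply hN, measureReal_restrict_apply MeasurableSet.univ,
      Set.univ_inter, smul_eq_mul, Set.inter_comm N U] at h1
    have h2 := hle.trans h1
    push_cast at h2
    have h3 : 0 ≤ K * (16 * P.real (U ∩ N) - u) := by linarith
    have := nonneg_of_mul_nonneg_right h3 hKr
    linarith
  have hbig : u / 64 ≤ subsetExp Finset.univ (fun _ => p)
      (fun S : Finset ι => P.real (U ∩ {ω | 1 < |ν (A ∩ π ⁻¹' (S : Set ι)) ω|})) := by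
    refine le_trans ?_ (hν.concentration_cells hπ hA hUm hp0.le hp1 1 K)
    have h1 : 1 / 4 ≤ 1 - (1 + (1 - 2 * p) ^ K) / 2 := by linarith
    calc u / 64 = 1 / 4 * (u / 16) := by ring
      _ ≤ _ := mul_le_mul h1 hN16 (by positivity) (by linarith)
  have hrest : (1 - p) * u ≤ subsetExp Finset.univ (fun _ => p)
      (fun S : Finset ι => P.real (U ∩ (boundedPart P ν (A \ (A ∩ π ⁻¹' (S : Set ι))))ᶜ)) := by
    refine measureReal_mul_le_subsetExp P
      (fun S => hUm.inter (measurableSet_boundedPart _).compl) hUm (fun _ => hp0.le)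
      (fun _ => by linarith) ?_
    have hex : ∀ᵐ ω ∂P, ω ∈ U → ∃ i, ω ∉ boundedPart P ν (A ∩ π ⁻¹' {i}) := by
      have := hν.measureReal_iInter_boundedPart hπ A
      rw [measureReal_eq_zero_iff] at this
      filter_upwards [compl_mem_ae_iff.2 this] with ω hω hωU
      by_contra hcon
      push Not at hcon
      exact hω ⟨Set.mem_iInter.2 hcon, hωU⟩
    have hsub : ∀ᵐ ω ∂P, ∀ (S : Finset ι) (i : ι), i ∉ S →
        ω ∈ boundedPart P ν (A \ (A ∩ π ⁻¹' (S : Set ι))) →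
        ω ∈ boundedPart P ν (A ∩ π ⁻¹' {i}) := by
      refine ae_all_iff.2 fun S => ae_all_iff.2 fun i => ?_
      by_cases hi : i ∈ S
      · exact Eventually.of_forall fun ω h => absurd hi h
      · have hincl : A ∩ π ⁻¹' {i} ⊆ A \ (A ∩ π ⁻¹' (S : Set ι)) := by
          rintro x ⟨hxA, hx⟩
          refine ⟨hxA, fun h => hi ?_⟩
          have h1 : π x = i := hx
          have h2 : π x ∈ S := h.2
          rwa [h1] at h2
        have := ((boundedOn_boundedPart (P := P) (ν := ν) (A \ (A ∩ π ⁻¹' (S : Set ι)))).mono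
          hincl le_rfl).measureReal_diff_boundedPart (measurableSet_boundedPart _)
        rw [measureReal_eq_zero_iff] at this
        filter_upwards [compl_mem_ae_iff.2 this] with ω hω _ hmem
        by_contra hcon
        exact hω ⟨hmem, hcon⟩
    filter_upwards [hex, hsub] with ω h1 h2 hωU
    obtain ⟨i, hi⟩ := h1 hωU
    have hmem := subsetExp_mem (s := Finset.univ) (fun _ : ι => p) (Finset.mem_univ i)
    have hle : subsetExp Finset.univ (fun _ => p) (fun _ : Finset ι => (1 : ℝ)) ≤
        subsetExp Finset.univ (fun _ => p) (fun S : Finset ι =>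
          (U ∩ (boundedPart P ν (A \ (A ∩ π ⁻¹' (S : Set ι))))ᶜ).indicator 1 ω +
            if i ∈ S then 1 else 0) := by
      refine subsetExp_mono (fun _ => hp0.le) (fun _ => by linarith) fun S _ => ?_
      have hnn : 0 ≤ (U ∩ (boundedPart P ν (A \ (A ∩ π ⁻¹' (S : Set ι))))ᶜ).indicator
          (1 : Ω → ℝ) ω := Set.indicator_nonneg (fun _ _ => zero_le_one) _
      split_ifs with hiS
      · linarith
      · rw [Set.indicator_of_mem (show ω ∈ U ∩ (boundedPart P ν (A \ (A ∩ π ⁻¹' (S : Set ι))))ᶜ from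
          ⟨hωU, fun h => hi (h2 S i hiS h)⟩)]
        simp
    rw [subsetExp_one, subsetExp_add, hmem] at hle
    linarith
  -- One selection must serve both purposes, so a weighted sum is maximised. With weight `1 / δ` and
  -- `p ≤ δ / 128`, bounding either term by `u` leaves the required estimate for the other.
  obtain ⟨S, -, hS⟩ := exists_subsetExp_le (s := (Finset.univ : Finset ι)) (p := fun _ => p)
    (fun _ => hp0.le) (fun _ => by linarith)
    (fun S => P.real (U ∩ {ω | 1 < |ν (A ∩ π ⁻¹' (S : Set ι)) ω|}) +
      1 / δ * P.real (U ∩ (boundedPart P ν (A \ (A ∩ π ⁻¹' (S : Set ι))))ᶜ))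
  rw [subsetExp_add, subsetExp_const_mul] at hS
  have hπS : MeasurableSet (π ⁻¹' (S : Set ι)) := by
    have : π ⁻¹' (S : Set ι) = ⋃ i ∈ S, π ⁻¹' {i} := by ext; simp
    rw [this]
    exact S.measurableSet_biUnion fun i _ => hπ i
  refine ⟨A ∩ π ⁻¹' S, Set.inter_subset_left, hA.inter hπS, ?_, ?_⟩
  all_goals
    have h1 : P.real (U ∩ {ω | 1 < |ν (A ∩ π ⁻¹' (S : Set ι)) ω|}) ≤
        P.real {ω | 1 < |ν (A ∩ π ⁻¹' (S : Set ι)) ω|} :=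
      measureReal_mono Set.inter_subset_right (measure_ne_top _ _)
    have h2 : P.real (U ∩ (boundedPart P ν (A \ (A ∩ π ⁻¹' (S : Set ι))))ᶜ) ≤
        P.real (boundedPart P ν (A \ (A ∩ π ⁻¹' (S : Set ι))))ᶜ :=
      measureReal_mono Set.inter_subset_right (measure_ne_top _ _)
    have h3 : P.real (U ∩ (boundedPart P ν (A \ (A ∩ π ⁻¹' (S : Set ι))))ᶜ) ≤ u :=
      measureReal_mono Set.inter_subset_left (measure_ne_top _ _)
    have h4 : P.real (U ∩ {ω | 1 < |ν (A ∩ π ⁻¹' (S : Set ι)) ω|}) ≤ u :=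
      measureReal_mono Set.inter_subset_left (measure_ne_top _ _)
    set X := P.real (U ∩ {ω | 1 < |ν (A ∩ π ⁻¹' (S : Set ι)) ω|})
    set Y := P.real (U ∩ (boundedPart P ν (A \ (A ∩ π ⁻¹' (S : Set ι))))ᶜ)
    have h5 : u / 64 + 1 / δ * ((1 - p) * u) ≤ X + 1 / δ * Y := by
      have : 1 / δ * ((1 - p) * u) ≤ 1 / δ * _ := mul_le_mul_of_nonneg_left hrest (by positivity)
      linarith
    have h6 : δ * (u / 64) + (1 - p) * u ≤ δ * X + Y := by
      have := mul_le_mul_of_nonneg_left h5 hδ.le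
      have e1 : δ * (u / 64 + 1 / δ * ((1 - p) * u)) = δ * (u / 64) + (1 - p) * u := by
        field_simp
      have e2 : δ * (X + 1 / δ * Y) = δ * X + Y := by field_simp
      linarith
    have hpu : p * u ≤ δ / 128 * u := mul_le_mul_of_nonneg_right hpδ hpos.le
  · have h7 : 0 ≤ δ * (X - u / 128) := by linarith
    have := nonneg_of_mul_nonneg_right h7 hδ
    linarith
  · have h8 : δ * X ≤ δ * u := mul_le_mul_of_nonneg_left h4 hδ.le
    have h9 : δ * u ≤ δ := mul_le_of_le_one_right hδ.le hu1
    have h10 : 0 ≤ δ * u := by positivity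
    linarith

/-- Talagrand's theorem: the range of an exhaustive charge with values in the space of random
variables is bounded in probability. -/
theorem bounded (hν : IsExhaustiveCharge P ν) : BoundedOn P ν Set.univ Set.univ := by
  have hzero : P.real (boundedPart P ν Set.univ)ᶜ = 0 := by
    by_contra hne
    have hpos := lt_of_le_of_ne measureReal_nonneg (Ne.symm hne)
    set u := P.real (boundedPart P ν Set.univ)ᶜ with hu
    -- The losses `u / 2 * (1/2) ^ (n + 1)` sum to `u / 2`, so the unbounded event never falls below
    -- `u / 2`. The removed disjoint sets then stay large with probability at least `u / 256`,
    -- against exhaustiveness.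
    have hstep : ∀ (n : ℕ) (A : Set 𝓧), ∃ B : Set 𝓧, MeasurableSet A ∧
        u / 2 + u / 2 * (1 / 2) ^ n ≤ P.real (boundedPart P ν A)ᶜ →
        B ⊆ A ∧ MeasurableSet B ∧ u / 256 ≤ P.real {ω | 1 < |ν B ω|} ∧
        u / 2 + u / 2 * (1 / 2) ^ (n + 1) ≤ P.real (boundedPart P ν (A \ B))ᶜ := by
      intro n A
      by_cases h : MeasurableSet A ∧ u / 2 + u / 2 * (1 / 2) ^ n ≤ P.real (boundedPart P ν A)ᶜ
      · obtain ⟨hA, hle⟩ := h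
        have hh : 0 < u / 2 * (1 / 2) ^ n := by positivity
        obtain ⟨B, hB, hBm, h1, h2⟩ := hν.exists_large_subset_complement hA (by linarith)
          (δ := u / 2 * (1 / 2) ^ (n + 1)) (by positivity)
        refine ⟨B, fun _ => ⟨hB, hBm, by linarith, ?_⟩⟩
        have e : u / 2 * (1 / 2 : ℝ) ^ n = 2 * (u / 2 * (1 / 2) ^ (n + 1)) := by ring
        linarith
      · exact ⟨∅, fun h' => absurd h' h⟩
    choose F hF using hstep
    set A : ℕ → Set 𝓧 := fun n => Nat.rec Set.univ (fun n A => A \ F n A) n with hAdef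
    have hAsucc : ∀ n, A (n + 1) = A n \ F n (A n) := fun n => rfl
    have hinv : ∀ n, MeasurableSet (A n) ∧
        u / 2 + u / 2 * (1 / 2) ^ n ≤ P.real (boundedPart P ν (A n))ᶜ := by
      intro n
      induction n with
      | zero => exact ⟨MeasurableSet.univ, by rw [pow_zero, mul_one, add_halves]; exact le_rfl⟩
      | succ n ih =>
        obtain ⟨-, h2, -, h4⟩ := hF n (A n) ih
        rw [hAsucc]
        exact ⟨ih.1.diff h2, h4⟩
    have hanti : Antitone A := antitone_nat_of_succ_le fun n => by
      rw [hAsucc]; exact Set.sdiff_subset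
    have hdisj : ∀ i j, i < j → Disjoint (F i (A i)) (F j (A j)) := by
      intro i j hij
      refine Set.disjoint_left.2 fun x hx hx' => ?_
      have h1 : x ∈ A (i + 1) := hanti hij ((hF j (A j) (hinv j)).1 hx')
      rw [hAsucc] at h1
      exact h1.2 hx
    have hlim := hν.exhaustive (fun n => F n (A n)) (fun n => (hF n (A n) (hinv n)).2.1)
      (fun i j hij => by
        rcases lt_or_gt_of_ne hij with h | h
        · exact hdisj i j h
        · exact (hdisj j i h).symm)
    have := ge_of_tendsto' hlim fun n => (hF n (A n) (hinv n)).2.2.1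
    linarith
  intro ε hε
  obtain ⟨C, hC⟩ := boundedOn_boundedPart (P := P) (ν := ν) Set.univ ε hε
  refine ⟨C, fun B hB hBm => ?_⟩
  have : P.real (Set.univ ∩ {ω | C < |ν B ω|}) ≤
      P.real (boundedPart P ν Set.univ ∩ {ω | C < |ν B ω|}) +
        P.real (boundedPart P ν Set.univ)ᶜ := by
    refine measureReal_le_add_of_subset_union ?_
    rintro ω ⟨-, hlt⟩
    by_cases h : ω ∈ boundedPart P ν Set.univ
    · exact Or.inl ⟨h, hlt⟩
    · exact Or.inr h
  linarith [hC B hB hBm]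

end IsExhaustiveCharge

end Talagrand

/-! ### Riemann sums of a path functional. -/

section Paths

/-- Fatou's lemma for left-endpoint step functions, which converge pointwise by continuity. The last
cell may overshoot `T₁`, which only enlarges the sum. -/
theorem lintegral_le_liminf_riemann_sum {F : ℝ → ℝ} {T₁ h : ℝ} (hh : 0 < h)
    (hF : ContinuousOn F (Set.Icc 0 T₁)) (hF0 : ∀ s, 0 ≤ F s) :
    ∫⁻ s in Set.Icc 0 T₁, ENNReal.ofReal (F s) ≤
      liminf (fun n : ℕ => ENNReal.ofReal (h / (n + 1) *
        ∑ j ∈ Finset.range (⌊T₁ / (h / (n + 1))⌋₊ + 1), F (j * (h / (n + 1))))) atTop := by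
  have hΔ : ∀ n : ℕ, 0 < h / (n + 1 : ℝ) := fun n => by positivity
  set G : ℕ → ℝ → ENNReal := fun n s =>
    ENNReal.ofReal (F (⌊s / (h / (n + 1))⌋₊ * (h / (n + 1)))) with hG
  have hGm : ∀ n, Measurable (G n) := fun n =>
    (measurable_from_top (f := fun k : ℕ => ENNReal.ofReal (F (k * (h / (n + 1)))))).comp
      (Nat.measurable_floor.comp (measurable_id.div_const _))
  calc ∫⁻ s in Set.Icc 0 T₁, ENNReal.ofReal (F s)
      = ∫⁻ s in Set.Icc 0 T₁, liminf (fun n => G n s) atTop := by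
        refine setLIntegral_congr_fun measurableSet_Icc fun s hs => ?_
        refine (Tendsto.liminf_eq ?_).symm
        refine (ENNReal.continuous_ofReal.tendsto _).comp ?_
        have hle : ∀ n : ℕ, (⌊s / (h / (n + 1))⌋₊ : ℝ) * (h / (n + 1)) ≤ s := fun n => by
          have := Nat.floor_le (div_nonneg hs.1 (hΔ n).le)
          rwa [le_div_iff₀ (hΔ n)] at this
        have hge : ∀ n : ℕ, s - h / (n + 1) ≤ (⌊s / (h / (n + 1))⌋₊ : ℝ) * (h / (n + 1)) :=
          fun n => by
            have := (Nat.lt_floor_add_one (s / (h / (n + 1 : ℝ))))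
            rw [div_lt_iff₀ (hΔ n)] at this
            linarith
        have hlim0 : Tendsto (fun n : ℕ => h / (n + 1 : ℝ)) atTop (𝓝 0) :=
          by simpa [div_eq_mul_inv] using
            (tendsto_one_div_add_atTop_nhds_zero_nat (𝕜 := ℝ)).const_mul h
        have hlim : Tendsto (fun n : ℕ => (⌊s / (h / (n + 1))⌋₊ : ℝ) * (h / (n + 1))) atTop
            (𝓝 s) := by
          refine tendsto_of_tendsto_of_tendsto_of_le_of_le ?_ tendsto_const_nhds hge hle
          simpa using hlim0.const_sub s
        refine (hF s hs).tendsto.comp (tendsto_nhdsWithin_iff.2 ⟨hlim, ?_⟩)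
        exact Eventually.of_forall fun n => ⟨mul_nonneg (Nat.cast_nonneg _) (hΔ n).le,
          (hle n).trans hs.2⟩
    _ ≤ liminf (fun n => ∫⁻ s in Set.Icc 0 T₁, G n s) atTop := lintegral_liminf_le hGm
    _ ≤ _ := by
        refine liminf_le_liminf (Eventually.of_forall fun n => ?_)
        set Δ := h / (n + 1 : ℝ)
        have hcover : Set.Icc 0 T₁ ⊆ ⋃ j ∈ Finset.range (⌊T₁ / Δ⌋₊ + 1),
            Set.Ico ((j : ℝ) * Δ) ((j + 1) * Δ) := by
          intro s hs
          refine Set.mem_biUnion (x := ⌊s / Δ⌋₊) ?_ ⟨?_, ?_⟩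
          · refine Finset.mem_coe.2 (Finset.mem_range.2 (Nat.lt_succ_of_le (Nat.floor_mono ?_)))
            exact div_le_div_of_nonneg_right hs.2 (hΔ n).le
          · have := Nat.floor_le (div_nonneg hs.1 (hΔ n).le)
            rwa [le_div_iff₀ (hΔ n)] at this
          · have := (Nat.lt_floor_add_one (s / Δ))
            rwa [div_lt_iff₀ (hΔ n)] at this
        have hd : Set.PairwiseDisjoint (↑(Finset.range (⌊T₁ / Δ⌋₊ + 1)) : Set ℕ)
            (fun j : ℕ => Set.Ico ((j : ℝ) * Δ) ((j + 1) * Δ)) := by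
          intro i _ j _ hij
          refine Set.disjoint_left.2 fun s hi hj => hij ?_
          have h1 : (i : ℝ) < j + 1 := lt_of_mul_lt_mul_right (hi.1.trans_lt hj.2) (hΔ n).le
          have h2 : (j : ℝ) < i + 1 := lt_of_mul_lt_mul_right (hj.1.trans_lt hi.2) (hΔ n).le
          have h1' : i < j + 1 := by exact_mod_cast h1
          have h2' : j < i + 1 := by exact_mod_cast h2
          omega
        calc ∫⁻ s in Set.Icc 0 T₁, G n s
            ≤ ∫⁻ s in ⋃ j ∈ Finset.range (⌊T₁ / Δ⌋₊ + 1),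
                Set.Ico ((j : ℝ) * Δ) ((j + 1) * Δ), G n s := lintegral_mono_set hcover
          _ = ∑ j ∈ Finset.range (⌊T₁ / Δ⌋₊ + 1),
                ∫⁻ s in Set.Ico ((j : ℝ) * Δ) ((j + 1) * Δ), G n s :=
              lintegral_biUnion_finset hd (fun _ _ => measurableSet_Ico) _
          _ = ∑ j ∈ Finset.range (⌊T₁ / Δ⌋₊ + 1), ENNReal.ofReal (Δ * F (j * Δ)) := by
              refine Finset.sum_congr rfl fun j _ => ?_
              have : ∫⁻ s in Set.Ico ((j : ℝ) * Δ) ((j + 1) * Δ), G n s =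
                  ∫⁻ s in Set.Ico ((j : ℝ) * Δ) ((j + 1) * Δ), ENNReal.ofReal (F (j * Δ)) := by
                refine setLIntegral_congr_fun measurableSet_Ico fun s hs => ?_
                have hf : ⌊s / Δ⌋₊ = j := by
                  have h0 : 0 ≤ s := le_trans (mul_nonneg (Nat.cast_nonneg _) (hΔ n).le) hs.1
                  rw [Nat.floor_eq_iff (div_nonneg h0 (hΔ n).le)]
                  exact ⟨(le_div_iff₀ (hΔ n)).2 hs.1, (div_lt_iff₀ (hΔ n)).2 hs.2⟩
                show ENNReal.ofReal (F (⌊s / Δ⌋₊ * Δ)) = _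
                rw [hf]
              rw [this, setLIntegral_const, Real.volume_Ico, mul_comm,
                ← ENNReal.ofReal_mul (by nlinarith [hΔ n])]
              congr 2
              ring
          _ = _ := by
              rw [← ENNReal.ofReal_sum_of_nonneg fun j _ => mul_nonneg (hΔ n).le (hF0 _),
                Finset.mul_sum]

theorem sum_Ico_telescope (g : ℕ → ℝ) (j n : ℕ) :
    ∑ l ∈ Finset.Ico j (j + n), (g (l + 1) - g l) = g (j + n) - g j := by
  rw [Finset.sum_Ico_eq_sum_range, add_tsub_cancel_left]
  exact Finset.sum_range_sub (fun k => g (j + k)) n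

end Paths

/-! ### A stochastic measure is an exhaustive charge. -/

namespace StochasticMeasure

variable {𝓧 : Type*} [MeasurableSpace 𝓧] {Ω : Type*} [MeasurableSpace Ω] {P : Measure Ω}

theorem tendsto_measureReal_le_abs_val [IsFiniteMeasure P] (μ : StochasticMeasure 𝓧 P)
    (A : ℕ → Set 𝓧) (hA : ∀ i, MeasurableSet (A i))
    (hd : Pairwise fun i j => Disjoint (A i) (A j)) {η : ℝ} (hη : 0 < η) :
    Tendsto (fun n => P.real {ω | η ≤ |μ.val (A n) ω|}) atTop (𝓝 0) := by
  have h := tendstoInMeasure_iff_measureReal_norm.1 (μ.sigma_additive A hA hd) (η / 2)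
    (by positivity)
  have h' := h.add (h.comp (tendsto_add_atTop_nat 1))
  rw [add_zero] at h'
  refine squeeze_zero (fun _ => measureReal_nonneg) (fun n => ?_) h'
  refine measureReal_le_add_of_subset_union fun ω hω => ?_
  by_contra hcon
  simp only [Set.mem_union, Set.mem_ofPred_eq, not_or, not_le, Real.norm_eq_abs,
    Finset.sum_range_succ] at hcon hω
  obtain ⟨h1, h2⟩ := hcon
  have := abs_sub (∑ i ∈ Finset.range n, μ.val (A i) ω + μ.val (A n) ω - μ.val (⋃ i, A i) ω)
    (∑ i ∈ Finset.range n, μ.val (A i) ω - μ.val (⋃ i, A i) ω)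
  rw [show ∑ i ∈ Finset.range n, μ.val (A i) ω + μ.val (A n) ω - μ.val (⋃ i, A i) ω -
    (∑ i ∈ Finset.range n, μ.val (A i) ω - μ.val (⋃ i, A i) ω) = μ.val (A n) ω by ring] at this
  linarith

/-- The constant sequence `∅` is pairwise disjoint, so its common value must tend to `0` in
probability. -/
theorem val_empty [IsFiniteMeasure P] (μ : StochasticMeasure 𝓧 P) : μ.val ∅ =ᵐ[P] 0 := by
  have h : ∀ n : ℕ, P.real {ω | 1 / ((n : ℝ) + 1) ≤ |μ.val ∅ ω|} = 0 := fun n =>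
    tendsto_nhds_unique tendsto_const_nhds (μ.tendsto_measureReal_le_abs_val (fun _ => ∅)
      (fun _ => .empty) (fun _ _ _ => disjoint_bot_left) (by positivity))
  have h' : ∀ n : ℕ, ∀ᵐ ω ∂P, |μ.val ∅ ω| < 1 / ((n : ℝ) + 1) := fun n => by
    have := h n
    rw [measureReal_eq_zero_iff] at this
    filter_upwards [compl_mem_ae_iff.2 this] with ω hω
    exact not_le.1 hω
  filter_upwards [ae_all_iff.2 h'] with ω hω
  refine abs_nonpos_iff.1 (ge_of_tendsto' tendsto_one_div_add_atTop_nhds_zero_nat fun n =>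
    (hω n).le)

theorem val_union [IsFiniteMeasure P] (μ : StochasticMeasure 𝓧 P) {A B : Set 𝓧}
    (hA : MeasurableSet A) (hB : MeasurableSet B) (hAB : Disjoint A B) :
    μ.val (A ∪ B) =ᵐ[P] fun ω => μ.val A ω + μ.val B ω := by
  set D : ℕ → Set 𝓧 := fun n => if n = 0 then A else if n = 1 then B else ∅ with hD
  have hDm : ∀ n, MeasurableSet (D n) := fun n => by
    simp only [hD]; split_ifs <;> simp [hA, hB]
  have hDd : Pairwise fun i j => Disjoint (D i) (D j) := by
    intro i j hij
    simp only [hD]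
    split_ifs <;> first | omega | simp [hAB.symm]
  have hU : ⋃ n, D n = A ∪ B := by
    ext x
    simp only [Set.mem_iUnion, hD, Set.mem_union]
    constructor
    · rintro ⟨n, hn⟩
      split_ifs at hn
      exacts [Or.inl hn, Or.inr hn, hn.elim]
    · rintro (h | h)
      exacts [⟨0, by simpa using h⟩, ⟨1, by simpa using h⟩]
  have h1 := (μ.sigma_additive D hDm hDd).comp (tendsto_add_atTop_nat 2)
  rw [hU] at h1
  refine tendstoInMeasure_ae_unique h1 ?_
  have h2 : ∀ n, (fun ω => ∑ i ∈ Finset.range (n + 2), μ.val (D i) ω) =ᵐ[P]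
      fun ω => μ.val A ω + μ.val B ω := by
    intro n
    filter_upwards [μ.val_empty] with ω hω
    rw [Finset.sum_range_succ', Finset.sum_range_succ']
    simp only [hD]
    simp [hω, add_comm]
  refine TendstoInMeasure.congr_left (fun n => (h2 n).symm) ?_
  intro ε hε
  simp only [edist_self, nonpos_iff_eq_zero, hε.ne']
  simp

theorem isExhaustiveCharge [IsFiniteMeasure P] (μ : StochasticMeasure 𝓧 P) :
    IsExhaustiveCharge P fun B => (μ.val B : Ω → ℝ) where
  measurable B := (μ.val B).measurable
  additive _ _ hA hB hAB := μ.val_union hA hB hAB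
  exhaustive B hB hd := by
    refine squeeze_zero (fun _ => measureReal_nonneg) (fun n => ?_)
      (μ.tendsto_measureReal_le_abs_val B hB hd one_pos)
    exact measureReal_mono (fun ω hω => show (1 : ℝ) ≤ |μ.val (B n) ω| from
      le_of_lt (show 1 < |μ.val (B n) ω| from hω)) (measure_ne_top _ _)

end StochasticMeasure

theorem IsExhaustiveCharge.sum_biUnion {𝓧 Ω : Type*} [MeasurableSpace 𝓧] [MeasurableSpace Ω]
    {P : Measure Ω} {ν : Set 𝓧 → Ω → ℝ} (hν : IsExhaustiveCharge P ν) {ι : Type*}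
    {D : ι → Set 𝓧} (hD : ∀ i, MeasurableSet (D i))
    (hd : Pairwise fun i j => Disjoint (D i) (D j)) (S : Finset ι) :
    ν (⋃ i ∈ S, D i) =ᵐ[P] fun ω => ∑ i ∈ S, ν (D i) ω := by
  classical
  induction S using Finset.induction_on with
  | empty =>
    simp only [Finset.notMem_empty, Set.iUnion_of_empty, Set.iUnion_empty, Finset.sum_empty]
    exact hν.empty
  | insert a S ha ih =>
    rw [Finset.set_biUnion_insert]
    have hdis : Disjoint (D a) (⋃ i ∈ S, D i) :=
      Set.disjoint_iUnion₂_right.2 fun i hi => hd fun h => ha (h ▸ hi)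
    filter_upwards [ih, hν.additive _ _ (hD a) (S.measurableSet_biUnion fun i _ => hD i) hdis]
      with ω h1 h2
    rw [h2, h1, Finset.sum_insert ha]

/-! ### Quadratic increments at a fixed mesh. -/

section PathIncrements

variable {Ω : Type*} [MeasurableSpace Ω] {P : Measure Ω} [IsProbabilityMeasure P] {T : ℝ}
  {μ : StochasticMeasure (Set.Icc (0 : ℝ) T) P} {X : ℝ → Ω → ℝ}

theorem increment_ae_eq
    (hX : ∀ t ∈ Set.Icc 0 T,
      X t =ᵐ[P] μ.val {x : Set.Icc (0 : ℝ) T | 0 < (x : ℝ) ∧ (x : ℝ) ≤ t})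
    {s t : ℝ} (hs : 0 ≤ s) (hst : s ≤ t) (ht : t ≤ T) :
    μ.val {x : Set.Icc (0 : ℝ) T | s < (x : ℝ) ∧ (x : ℝ) ≤ t} =ᵐ[P] fun ω => X t ω - X s ω := by
  have hm : ∀ a b : ℝ, MeasurableSet {x : Set.Icc (0 : ℝ) T | a < (x : ℝ) ∧ (x : ℝ) ≤ b} :=
    fun a b => (measurableSet_lt measurable_const measurable_subtype_coe).inter
      (measurableSet_le measurable_subtype_coe measurable_const)
  have hU : {x : Set.Icc (0 : ℝ) T | 0 < (x : ℝ) ∧ (x : ℝ) ≤ t} =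
      {x : Set.Icc (0 : ℝ) T | 0 < (x : ℝ) ∧ (x : ℝ) ≤ s} ∪
      {x : Set.Icc (0 : ℝ) T | s < (x : ℝ) ∧ (x : ℝ) ≤ t} := by
    ext x
    simp only [Set.mem_ofPred_eq, Set.mem_union]
    constructor
    · rintro ⟨h1, h2⟩
      rcases le_or_gt (x : ℝ) s with h | h
      exacts [Or.inl ⟨h1, h⟩, Or.inr ⟨h, h2⟩]
    · rintro (⟨h1, h2⟩ | ⟨h1, h2⟩)
      exacts [⟨h1, h2.trans hst⟩, ⟨hs.trans_lt h1, h2⟩]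
  have hd : Disjoint {x : Set.Icc (0 : ℝ) T | 0 < (x : ℝ) ∧ (x : ℝ) ≤ s}
      {x : Set.Icc (0 : ℝ) T | s < (x : ℝ) ∧ (x : ℝ) ≤ t} :=
    Set.disjoint_left.2 fun x hx hx' => absurd hx.2 (not_le.2 hx'.1)
  have hadd := μ.val_union (hm 0 s) (hm s t) hd
  rw [← hU] at hadd
  filter_upwards [hX s ⟨hs, hst.trans ht⟩, hX t ⟨hs.trans hst, ht⟩, hadd] with ω h1 h2 h3
  rw [h1, h2, h3]
  ring

/-- The sums `n⁻¹ ∑ (X (jΔ + nΔ) - X (jΔ))²` are bounded in probability. -/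
theorem exists_bound_sum_sq_increments
    (hX : ∀ t ∈ Set.Icc 0 T,
      X t =ᵐ[P] μ.val {x : Set.Icc (0 : ℝ) T | 0 < (x : ℝ) ∧ (x : ℝ) ≤ t})
    {ε : ℝ} (hε : 0 < ε) :
    ∃ K : ℝ, 0 < K ∧ ∀ (Δ : ℝ) (n N : ℕ), 0 < Δ → 0 < n → (N + n : ℕ) * Δ ≤ T →
      P.real {ω | K < 1 / n * ∑ j ∈ Finset.range (N + 1),
        (X ((j + n : ℕ) * Δ) ω - X (j * Δ) ω) ^ 2} ≤ ε := by
  have hν := μ.isExhaustiveCharge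
  choose C₀ hC₀ using hν.bounded
  -- Adding `1` to the bound makes it positive and turns the strict inequality in `BoundedOn` into a
  -- non-strict one; the value for `ε ≤ 0` is a dummy.
  set C : ℝ → ℝ := fun ε => if h : 0 < ε then |C₀ ε h| + 1 else 1 with hC
  have hCpos : ∀ ε, 0 < ε → 0 < C ε := fun ε h => by
    simp only [hC, dif_pos h]; positivity
  obtain ⟨K, hK0, hK⟩ := exists_square_function_bound P hCpos hε
  refine ⟨K, hK0, fun Δ n N hΔ hn hT => ?_⟩
  have hnr : (0 : ℝ) < n := by exact_mod_cast hn
  set D : Fin (N + n) → Set (Set.Icc (0 : ℝ) T) :=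
    fun l => {x | (l : ℕ) * Δ < (x : ℝ) ∧ (x : ℝ) ≤ ((l : ℕ) + 1 : ℕ) * Δ} with hD
  have hDm : ∀ l, MeasurableSet (D l) := fun l =>
    (measurableSet_lt measurable_const measurable_subtype_coe).inter
      (measurableSet_le measurable_subtype_coe measurable_const)
  have hDd : Pairwise fun i j => Disjoint (D i) (D j) := by
    intro i j hij
    refine Set.disjoint_left.2 fun x hi hj => hij ?_
    have h1 : ((i : ℕ) : ℝ) < ((j : ℕ) + 1 : ℕ) :=
      lt_of_mul_lt_mul_right (hi.1.trans_le hj.2) hΔ.le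
    have h2 : ((j : ℕ) : ℝ) < ((i : ℕ) + 1 : ℕ) :=
      lt_of_mul_lt_mul_right (hj.1.trans_le hi.2) hΔ.le
    have h1' : (i : ℕ) < j + 1 := by exact_mod_cast h1
    have h2' : (j : ℕ) < i + 1 := by exact_mod_cast h2
    exact Fin.ext (by omega)
  -- Normalised indicator of the window of `n` consecutive cells starting at `j`. A cell lies in at
  -- most `n` windows, so the squares sum to at most `1`.
  set f : Fin (N + 1) → Fin (N + n) → ℝ := fun j l =>
    √(1 / n) * if (j : ℕ) ≤ l ∧ (l : ℕ) < j + n then 1 else 0 with hf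
  have hsq : √(1 / (n : ℝ)) ^ 2 = 1 / n := Real.sq_sqrt (by positivity)
  have hf1 : ∀ l, ∑ j, f j l ^ 2 ≤ 1 := by
    intro l
    simp only [hf, mul_pow, hsq, ite_pow, one_pow, zero_pow two_ne_zero]
    rw [← Finset.mul_sum, Finset.sum_boole, one_div, inv_mul_le_iff₀ hnr, mul_one]
    have : (Finset.univ.filter fun j : Fin (N + 1) => (j : ℕ) ≤ l ∧ (l : ℕ) < j + n).card ≤ n := by
      calc _ ≤ (Finset.Ico ((l : ℕ) + 1 - n) (l + 1)).card := by
            refine Finset.card_le_card_of_injOn (fun j => (j : ℕ)) (fun j hj => ?_)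
              (fun a _ b _ h => Fin.ext h)
            simp only [Finset.coe_filter, Finset.mem_univ, true_and, Set.mem_ofPred_eq] at hj
            simp only [Finset.coe_Ico, Set.mem_Ico]
            omega
        _ ≤ n := by rw [Nat.card_Ico]; omega
    exact_mod_cast this
  have hmain := hK (Fin (N + n)) (fun l => μ.val (D l)) (fun l => (μ.val (D l)).measurable)
    (fun ε hε S => by
      refine le_trans ?_ (hC₀ ε hε (⋃ i ∈ S, D i) (Set.subset_univ _)
        (S.measurableSet_biUnion fun i _ => hDm i))
      refine ENNReal.toReal_mono (measure_ne_top _ _) (measure_mono_ae ?_)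
      filter_upwards [hν.sum_biUnion hDm hDd S] with ω hω hmem
      refine ⟨Set.mem_univ _, ?_⟩
      have h1 : C ε ≤ |∑ i ∈ S, μ.val (D i) ω| := hmem
      show C₀ ε hε < _
      rw [hω]
      simp only [hC, dif_pos hε] at h1
      linarith [le_abs_self (C₀ ε hε)]) (Fin (N + 1)) f hf1
  refine le_trans (le_of_eq ?_) hmain
  refine measureReal_congr ?_
  have hinc : ∀ᵐ ω ∂P, ∀ l : Fin (N + n),
      μ.val (D l) ω = X (((l : ℕ) + 1 : ℕ) * Δ) ω - X ((l : ℕ) * Δ) ω := by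
    refine ae_all_iff.2 fun l => increment_ae_eq hX (by positivity) ?_ ?_
    · gcongr; omega
    · refine le_trans ?_ hT
      exact mul_le_mul_of_nonneg_right (Nat.cast_le.2 (Nat.succ_le_of_lt l.2)) hΔ.le
  filter_upwards [hinc] with ω hω
  have e : ∑ j, randomSum (fun l => (μ.val (D l) : Ω → ℝ)) (f j) ω ^ 2 =
      1 / n * ∑ j ∈ Finset.range (N + 1), (X ((j + n : ℕ) * Δ) ω - X (j * Δ) ω) ^ 2 := by
    rw [← Fin.sum_univ_eq_sum_range
      (fun j => (X ((j + n : ℕ) * Δ) ω - X (j * Δ) ω) ^ 2), Finset.mul_sum]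
    refine Finset.sum_congr rfl fun j _ => ?_
    have hj : randomSum (fun l => (μ.val (D l) : Ω → ℝ)) (f j) ω =
        √(1 / n) * (X (((j : ℕ) + n : ℕ) * Δ) ω - X ((j : ℕ) * Δ) ω) := by
      simp only [randomSum, hf, mul_assoc]
      rw [← Finset.mul_sum]
      congr 1
      have h1 : ∑ l : Fin (N + n), (if (j : ℕ) ≤ l ∧ (l : ℕ) < j + n then (1 : ℝ) else 0) *
          μ.val (D l) ω = ∑ l : Fin (N + n), (fun l : ℕ => if (j : ℕ) ≤ l ∧ l < j + n then
            X ((l + 1 : ℕ) * Δ) ω - X (l * Δ) ω else 0) l := by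
        refine Finset.sum_congr rfl fun l _ => ?_
        rw [hω l]
        by_cases hc : ((j : ℕ) ≤ l ∧ (l : ℕ) < j + n)
        · simp only [if_pos hc, one_mul]
        · simp only [if_neg hc, zero_mul]
      rw [h1, Fin.sum_univ_eq_sum_range (fun l : ℕ => if (j : ℕ) ≤ l ∧ l < j + n then
            X ((l + 1 : ℕ) * Δ) ω - X (l * Δ) ω else 0), ← Finset.sum_filter]
      have h2 : (Finset.range (N + n)).filter (fun l => (j : ℕ) ≤ l ∧ l < j + n) =
          Finset.Ico (j : ℕ) (j + n) := by
        ext l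
        have := j.2
        simp only [Finset.mem_filter, Finset.mem_range, Finset.mem_Ico]
        omega
      rw [h2]
      exact sum_Ico_telescope (fun l : ℕ => X (l * Δ) ω) j n
    rw [hj, mul_pow, hsq]
  show (K < _) = (K < _)
  rw [e]

end PathIncrements

/-- Almost all of `A` lies in the lower limit of the `E k`, an increasing union of sets of measure
at most `c`. This carries the uniform bound for Riemann sums over to the integral. -/
theorem measure_le_of_forall_subset_eventually {Ω : Type*} [MeasurableSpace Ω] {P : Measure Ω}
    {A : Set Ω} {E : ℕ → Set Ω} {c : ENNReal} (hE : ∀ k, P (E k) ≤ c)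
    (hA : ∀ᵐ ω ∂P, ω ∈ A → ∀ᶠ k in atTop, ω ∈ E k) : P A ≤ c := by
  have hmono : Monotone fun m : ℕ => ⋂ k ≥ m, E k := fun m n hmn =>
    Set.biInter_subset_biInter_left fun k (hk : n ≤ k) => hmn.trans hk
  have h1 : P A ≤ P (⋃ m : ℕ, ⋂ k ≥ m, E k) := by
    refine measure_mono_ae ?_
    filter_upwards [hA] with ω hω hmem
    obtain ⟨m, hm⟩ := eventually_atTop.1 (hω hmem)
    exact Set.mem_iUnion.2 ⟨m, Set.mem_iInter₂.2 hm⟩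
  refine h1.trans (le_of_tendsto' (tendsto_measure_iUnion_atTop hmono) fun m => ?_)
  exact (measure_mono (Set.biInter_subset_of_mem (show m ≥ m from le_rfl))).trans (hE m)

/-! ### From bounded quadratic increments to vanishing higher powers. -/

section PathIncrements

variable {Ω : Type*} [MeasurableSpace Ω] {P : Measure Ω} [IsProbabilityMeasure P] {T T₁ : ℝ}
  {μ : StochasticMeasure (Set.Icc (0 : ℝ) T) P} {X : ℝ → Ω → ℝ}

theorem continuousOn_increment {x : ℝ → ℝ} (hx : ContinuousOn x (Set.Icc 0 T)) {h : ℝ}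
    (hh : 0 < h) (hhT : h ≤ T - T₁) :
    ContinuousOn (fun s => x (s + h) - x s) (Set.Icc 0 T₁) := by
  refine ContinuousOn.sub (hx.comp (by fun_prop) fun s hs => ⟨?_, ?_⟩)
    (hx.mono fun s hs => ⟨hs.1, ?_⟩)
  all_goals linarith [hs.1, hs.2]

/-- The quotients `h⁻¹ ∫ (X (s + h) - X s)² ds` are bounded in probability. -/
theorem exists_bound_lintegral_sq_increments (hT₁ : 0 ≤ T₁)
    (hX : ∀ t ∈ Set.Icc 0 T,
      X t =ᵐ[P] μ.val {x : Set.Icc (0 : ℝ) T | 0 < (x : ℝ) ∧ (x : ℝ) ≤ t})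
    (hcont : ∀ᵐ ω ∂P, ContinuousOn (fun t => X t ω) (Set.Icc 0 T)) {ε : ℝ} (hε : 0 < ε) :
    ∃ K : ℝ, 0 < K ∧ ∀ h, 0 < h → h ≤ T - T₁ →
      P {ω | ENNReal.ofReal (K * h) < ∫⁻ s in Set.Icc 0 T₁,
        ENNReal.ofReal ((X (s + h) ω - X s ω) ^ 2)} ≤ ENNReal.ofReal ε := by
  obtain ⟨K, hK0, hK⟩ := exists_bound_sum_sq_increments hX hε
  refine ⟨K, hK0, fun h hh hhT => ?_⟩
  refine measure_le_of_forall_subset_eventually (E := fun k : ℕ =>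
    {ω | K < 1 / (k + 1 : ℕ) * ∑ j ∈ Finset.range (⌊T₁ / (h / (k + 1))⌋₊ + 1),
      (X ((j + (k + 1) : ℕ) * (h / (k + 1))) ω - X (j * (h / (k + 1))) ω) ^ 2}) (fun k => ?_) ?_
  · have hΔ : 0 < h / (k + 1 : ℝ) := by positivity
    have := hK (h / (k + 1)) (k + 1) ⌊T₁ / (h / (k + 1))⌋₊ hΔ k.succ_pos ?_
    · rw [← ofReal_measureReal]
      exact ENNReal.ofReal_le_ofReal this
    · have h1 := Nat.floor_le (div_nonneg hT₁ hΔ.le)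
      rw [le_div_iff₀ hΔ] at h1
      have h2 : ((k + 1 : ℕ) : ℝ) * (h / (k + 1)) = h := by
        push_cast; field_simp
      rw [Nat.cast_add, add_mul, h2]
      linarith
  · filter_upwards [hcont] with ω hω hlt
    have hF := (continuousOn_increment hω hh hhT).pow 2
    have hlim := (show _ < _ from hlt).trans_le
      (lintegral_le_liminf_riemann_sum hh hF fun s => sq_nonneg _)
    filter_upwards [eventually_lt_of_lt_liminf hlim] with k hk
    have hk1 : (0 : ℝ) < k + 1 := by positivity
    have h1 := (ENNReal.ofReal_lt_ofReal_iff_of_nonneg (by positivity)).1 hk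
    show K < _
    have h2 : ∀ j : ℕ, ((j + (k + 1) : ℕ) : ℝ) * (h / (k + 1)) = j * (h / (k + 1)) + h := by
      intro j
      push_cast
      field_simp
    simp only [h2]
    refine lt_of_mul_lt_mul_right (h1.trans_eq ?_) hh.le
    push_cast
    ring

/-- The modulus of continuity of a continuous process is small in probability. -/
theorem exists_modulus_of_continuity (hT : 0 ≤ T)
    (hm : ∀ t ∈ Set.Icc 0 T, AEMeasurable (X t) P)
    (hcont : ∀ᵐ ω ∂P, ContinuousOn (fun t => X t ω) (Set.Icc 0 T)) {ρ : ℝ} (hρ : 0 < ρ)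
    {ε : ENNReal} (hε : 0 < ε) :
    ∃ η : ℝ, 0 < η ∧ P {ω | ¬ ∀ s ∈ Set.Icc 0 T, ∀ t ∈ Set.Icc 0 T, |s - t| < η →
      |X s ω - X t ω| ≤ ρ} ≤ ε := by
  -- Clamping to `[0, T]` lets all rationals serve as a countable dense set of times, so the
  -- exceptional events are null-measurable.
  set c : ℝ → ℝ := fun x => (Set.projIcc 0 T hT x : ℝ) with hc
  have hcm : ∀ x, c x ∈ Set.Icc 0 T := fun x => (Set.projIcc 0 T hT x).2
  have hcc : Continuous c := continuous_subtype_val.comp continuous_projIcc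
  have hcs : ∀ x ∈ Set.Icc 0 T, c x = x := fun x hx => by
    simp only [hc, Set.projIcc_of_mem hT hx]
  set W : ℕ → Set Ω := fun n => ⋃ (q : ℚ) (r : ℚ) (_ : |c q - c r| < 1 / ((n : ℝ) + 1)),
    {ω | ρ < |X (c q) ω - X (c r) ω|} with hW
  have hWmem : ∀ n ω, ω ∈ W n ↔ ∃ q r : ℚ, |c q - c r| < 1 / ((n : ℝ) + 1) ∧
      ρ < |X (c q) ω - X (c r) ω| := by
    intro n ω
    simp only [hW, Set.mem_iUnion, Set.mem_ofPred_eq, exists_prop]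
  have hWm : ∀ n, NullMeasurableSet (W n) P := fun n =>
    .iUnion fun q => .iUnion fun r => .iUnion fun _ =>
      nullMeasurableSet_lt aemeasurable_const
        ((hm _ (hcm q)).sub (hm _ (hcm r))).abs
  have hWa : Antitone W := by
    intro m n hmn ω hω
    obtain ⟨q, r, h1, h2⟩ := (hWmem n ω).1 hω
    exact (hWmem m ω).2 ⟨q, r, h1.trans_le (Nat.one_div_le_one_div hmn), h2⟩
  have hW0 : P (⋂ n, W n) = 0 := by
    refine measure_mono_null (t := {ω | ¬ ContinuousOn (fun t => X t ω) (Set.Icc 0 T)})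
      (fun ω hω hωc => ?_) (ae_iff.1 hcont)
    obtain ⟨η, hη, hu⟩ := Metric.uniformContinuousOn_iff.1
      (isCompact_Icc.uniformContinuousOn_of_continuous hωc) ρ hρ
    obtain ⟨n, hn⟩ := exists_nat_one_div_lt hη
    obtain ⟨q, r, h1, h2⟩ := (hWmem n ω).1 (Set.mem_iInter.1 hω n)
    have := hu _ (hcm q) _ (hcm r) (by rw [Real.dist_eq]; exact h1.trans hn)
    rw [Real.dist_eq] at this
    exact absurd this (not_lt.2 h2.le)
  have hlim := tendsto_measure_iInter_atTop hWm hWa ⟨0, measure_ne_top P _⟩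
  rw [hW0] at hlim
  obtain ⟨n, hn⟩ := (ENNReal.tendsto_nhds_zero.1 hlim ε hε).exists
  refine ⟨1 / ((n : ℝ) + 1), by positivity, le_trans (measure_mono_ae ?_) hn⟩
  filter_upwards [hcont] with ω hω hbad
  by_contra hnW
  refine hbad fun s hs t ht hst => ?_
  have hG : Continuous fun x => X (c x) ω := hω.comp_continuous hcc hcm
  -- The strict condition is open and the desired bound is closed, so the bound extends from
  -- rational pairs to all admissible pairs by density.
  have hU : IsOpen {p : ℝ × ℝ | |c p.1 - c p.2| < 1 / ((n : ℝ) + 1)} :=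
    isOpen_lt (by fun_prop) continuous_const
  have hF : IsClosed {p : ℝ × ℝ | |X (c p.1) ω - X (c p.2) ω| ≤ ρ} :=
    isClosed_le ((hG.comp continuous_fst).sub (hG.comp continuous_snd)).abs continuous_const
  have hD : Dense (Set.range (Prod.map ((↑) : ℚ → ℝ) ((↑) : ℚ → ℝ))) :=
    Rat.denseRange_cast.prodMap Rat.denseRange_cast
  have hmem : (s, t) ∈ {p : ℝ × ℝ | |X (c p.1) ω - X (c p.2) ω| ≤ ρ} := by
    refine closure_minimal ?_ hF (hD.open_subset_closure_inter hU ?_)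
    · rintro _ ⟨hp, ⟨⟨q, r⟩, rfl⟩⟩
      by_contra hcon
      exact hnW ((hWmem n ω).2 ⟨q, r, hp, not_le.1 hcon⟩)
    · show |c s - c t| < _
      rwa [hcs s hs, hcs t ht]
  have h3 : |X (c s) ω - X (c t) ω| ≤ ρ := hmem
  rwa [hcs s hs, hcs t ht] at h3

/-- The extra power `|f| ^ δ` is bounded by `ρ ^ δ`; the remaining square is controlled by the
quadratic estimate. -/
theorem integral_rpow_le_of_lintegral_sq_le {f : ℝ → ℝ} {ρ δ c : ℝ} (hδ : 0 < δ)
    (hc : 0 ≤ c) (hf : ContinuousOn f (Set.Icc 0 T₁)) (hρ : ∀ s ∈ Set.Icc 0 T₁, |f s| ≤ ρ)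
    (hc' : ∫⁻ s in Set.Icc 0 T₁, ENNReal.ofReal (f s ^ 2) ≤ ENNReal.ofReal c) (hρ0 : 0 ≤ ρ) :
    ∫ s in Set.Icc 0 T₁, |f s| ^ (2 + δ) ≤ ρ ^ δ * c := by
  have h1 : ∫ s in Set.Icc 0 T₁, |f s| ^ (2 + δ) ≤ ∫ s in Set.Icc 0 T₁, ρ ^ δ * f s ^ 2 := by
    refine setIntegral_mono_on ?_ ?_ measurableSet_Icc fun s hs => ?_
    · exact (hf.abs.rpow_const fun _ _ => Or.inr (by linarith)).integrableOn_Icc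
    · exact (continuousOn_const.mul (hf.pow 2)).integrableOn_Icc
    · rw [Real.rpow_add' (abs_nonneg _) (by linarith), Real.rpow_two, sq_abs, mul_comm]
      exact mul_le_mul_of_nonneg_right
        (Real.rpow_le_rpow (abs_nonneg _) (hρ s hs) hδ.le) (sq_nonneg _)
  refine h1.trans ?_
  rw [integral_const_mul, integral_eq_lintegral_of_nonneg_ae
    (Eventually.of_forall fun s => sq_nonneg _)
    ((hf.pow 2).aestronglyMeasurable measurableSet_Icc)]
  exact mul_le_mul_of_nonneg_left (ENNReal.toReal_le_of_le_ofReal hc hc') (by positivity)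

theorem tendstoInMeasure_integral_rpow_increments (hT₁ : 0 ≤ T₁) (hT₁T : T₁ < T)
    (hX : ∀ t ∈ Set.Icc 0 T,
      X t =ᵐ[P] μ.val {x : Set.Icc (0 : ℝ) T | 0 < (x : ℝ) ∧ (x : ℝ) ≤ t})
    (hcont : ∀ᵐ ω ∂P, ContinuousOn (fun t => X t ω) (Set.Icc 0 T)) {δ : ℝ} (hδ : 0 < δ) :
    TendstoInMeasure P
      (fun (ε : ℝ) ω => 1 / ε * ∫ s in Set.Icc 0 T₁, |X (s + ε) ω - X s ω| ^ (2 + δ))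
      (𝓝[>] 0) (fun _ => 0) := by
  rw [tendstoInMeasure_iff_norm]
  intro η hη
  refine ENNReal.tendsto_nhds_zero.2 fun ε hε => ?_
  obtain ⟨r, hr0, hrε⟩ := ENNReal.lt_iff_exists_nnreal_btwn.1 hε
  have hr : (0 : ℝ) < r := by exact_mod_cast hr0
  obtain ⟨K, hK0, hK⟩ := exists_bound_lintegral_sq_increments hT₁ hX hcont (half_pos hr)
  -- Chosen so that `ρ ^ δ * K = η / 2`.
  set ρ : ℝ := (η / (2 * K)) ^ δ⁻¹ with hρdef
  have hρ0 : 0 < ρ := by positivity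
  have hρK : ρ ^ δ * K < η := by
    rw [hρdef, Real.rpow_inv_rpow (by positivity) hδ.ne', div_mul_eq_mul_div,
      div_lt_iff₀ (by positivity)]
    nlinarith
  obtain ⟨d, hd, hmod⟩ := exists_modulus_of_continuity (by linarith)
    (fun t ht => (μ.val _).measurable.aemeasurable.congr (hX t ht).symm) hcont hρ0
    (ε := ENNReal.ofReal (r / 2)) (by simpa using hr)
  have hsmall : ∀ᶠ h : ℝ in 𝓝[>] 0, h < min d (T - T₁) :=
    nhdsWithin_le_nhds (gt_mem_nhds (lt_min hd (by linarith)))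
  filter_upwards [hsmall, self_mem_nhdsWithin] with h hh1 hh
  have hh : 0 < h := hh
  have hhT : h ≤ T - T₁ := (hh1.trans_le (min_le_right _ _)).le
  have hhd : h < d := hh1.trans_le (min_le_left _ _)
  calc P {ω | η ≤ ‖1 / h * (∫ s in Set.Icc 0 T₁, |X (s + h) ω - X s ω| ^ (2 + δ)) - 0‖}
      ≤ P ({ω | ENNReal.ofReal (K * h) < ∫⁻ s in Set.Icc 0 T₁,
          ENNReal.ofReal ((X (s + h) ω - X s ω) ^ 2)} ∪
        {ω | ¬ ∀ s ∈ Set.Icc 0 T, ∀ t ∈ Set.Icc 0 T, |s - t| < d → |X s ω - X t ω| ≤ ρ}) := by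
        refine measure_mono_ae ?_
        filter_upwards [hcont] with ω hω hbad
        by_contra hcon
        obtain ⟨h1, h2⟩ := not_or.1 hcon
        rw [Set.mem_ofPred_eq, not_lt] at h1
        rw [Set.mem_ofPred_eq, not_not] at h2
        have hle := integral_rpow_le_of_lintegral_sq_le hδ (by positivity)
          (continuousOn_increment hω hh hhT) (fun s hs => h2 (s + h)
            ⟨by linarith [hs.1], by linarith [hs.2]⟩ s ⟨hs.1, by linarith [hs.2]⟩
            (by rwa [add_sub_cancel_left, abs_of_pos hh])) h1 hρ0.le
        have hbad' : η ≤ ‖1 / h * (∫ s in Set.Icc 0 T₁, |X (s + h) ω - X s ω| ^ (2 + δ)) - 0‖ :=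
          hbad
        rw [sub_zero, Real.norm_of_nonneg (mul_nonneg (by positivity)
          (integral_nonneg fun s => Real.rpow_nonneg (abs_nonneg _) _)), one_div,
          le_inv_mul_iff₀ hh] at hbad'
        nlinarith
    _ ≤ ENNReal.ofReal (r / 2) + ENNReal.ofReal (r / 2) :=
        (measure_union_le _ _).trans (add_le_add (hK h hh hhT) hmod)
    _ ≤ ε := by
        rw [← ENNReal.ofReal_add (by positivity) (by positivity), add_halves,
          ENNReal.ofReal_coe_nnreal]
        exact hrε.le

end PathIncrements

/-- The full integral of the absolute cube dominates the supremum over `t`. Convergence in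
probability yields an almost surely convergent, hence bounded, subsequence. -/
theorem hasStrongVariation_three_zero {Ω : Type*} [MeasurableSpace Ω] {P : Measure Ω} {T T₁ : ℝ}
    {X : ℝ → Ω → ℝ} (hT₁T : T₁ < T)
    (hcont : ∀ᵐ ω ∂P, ContinuousOn (fun t => X t ω) (Set.Icc 0 T))
    (h : TendstoInMeasure P
      (fun (ε : ℝ) ω => 1 / ε * ∫ s in Set.Icc 0 T₁, |X (s + ε) ω - X s ω| ^ 3)
      (𝓝[>] 0) (fun _ => 0)) :
    HasStrongVariation P X 3 T₁ (fun _ _ => 0) := by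
  refine ⟨fun η hη => ?_, fun e he0 he => ?_⟩
  · refine tendsto_of_tendsto_of_tendsto_of_le_of_le' tendsto_const_nhds
      (tendstoInMeasure_iff_norm.1 h η hη) (Eventually.of_forall fun _ => zero_le) ?_
    have hsmall : ∀ᶠ ε : ℝ in 𝓝[>] 0, ε < T - T₁ :=
      nhdsWithin_le_nhds (gt_mem_nhds (by linarith))
    filter_upwards [hsmall, self_mem_nhdsWithin] with ε hε1 hε
    have hε : 0 < ε := hε
    refine measure_mono_ae ?_
    filter_upwards [hcont] with ω hω hmem
    have hmem' : ENNReal.ofReal η ≤ ⨆ t ∈ Set.Icc 0 T₁, ENNReal.ofReal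
      |1 / ε * (∫ s in Set.Icc 0 t, (X (s + ε) ω - X s ω) ^ 3) - 0| := hmem
    have hnn : 0 ≤ 1 / ε * ∫ s in Set.Icc 0 T₁, |X (s + ε) ω - X s ω| ^ 3 :=
      mul_nonneg (by positivity) (integral_nonneg fun s => by positivity)
    show η ≤ ‖1 / ε * (∫ s in Set.Icc 0 T₁, |X (s + ε) ω - X s ω| ^ 3) - 0‖
    rw [sub_zero, Real.norm_of_nonneg hnn, ← ENNReal.ofReal_le_ofReal_iff hnn]
    refine hmem'.trans (iSup₂_le fun t ht => ENNReal.ofReal_le_ofReal ?_)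
    rw [sub_zero, abs_mul, abs_of_pos (one_div_pos.2 hε)]
    refine mul_le_mul_of_nonneg_left ?_ (one_div_pos.2 hε).le
    refine (abs_integral_le_integral_abs).trans ?_
    simp only [abs_pow]
    refine setIntegral_mono_set ?_ (Eventually.of_forall fun s => by positivity)
      (Set.Icc_subset_Icc_right ht.2).eventuallyLE
    exact ((continuousOn_increment hω hε hε1.le).abs.pow 3).integrableOn_Icc
  · have he' : Tendsto e atTop (𝓝[>] 0) :=
      tendsto_nhdsWithin_iff.2 ⟨he, Eventually.of_forall he0⟩
    obtain ⟨φ, hφ, hlim⟩ := (h.comp he').exists_seq_tendsto_ae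
    refine ⟨φ, hφ, ?_⟩
    filter_upwards [hlim] with ω hω
    exact hω.bddAbove_range

/-- `X t` is a version of `μ_t = μ((0, t])`, `0 ≤ t ≤ T`, with (almost surely) continuous paths. -/
theorem mainTheorem5 {Ω : Type*} [MeasurableSpace Ω] (P : Measure Ω) [IsProbabilityMeasure P]
    (T : ℝ) (μ : StochasticMeasure (Set.Icc (0 : ℝ) T) P)
    (hμ : μ.SquareIntegrableDominated)
    (X : ℝ → Ω → ℝ)
    (hX : ∀ t ∈ Set.Icc 0 T,
      X t =ᵐ[P] μ.val {x : Set.Icc (0 : ℝ) T | 0 < (x : ℝ) ∧ (x : ℝ) ≤ t})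
    (hcont : ∀ᵐ ω ∂P, ContinuousOn (fun t => X t ω) (Set.Icc 0 T))
    (T₁ : ℝ) (hT₁ : 0 < T₁) (hT₁T : T₁ < T) :
    (∀ δ : ℝ, 0 < δ →
      TendstoInMeasure P
        (fun (ε : ℝ) ω => 1 / ε * ∫ s in Set.Icc 0 T₁, |X (s + ε) ω - X s ω| ^ (2 + δ))
        (𝓝[>] 0) (fun _ => 0)) ∧
    HasStrongVariation P X 3 T₁ (fun _ _ => 0) := by
  have h := fun (δ : ℝ) (hδ : 0 < δ) =>
    tendstoInMeasure_integral_rpow_increments hT₁.le hT₁T hX hcont hδ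
  refine ⟨h, hasStrongVariation_three_zero hT₁T hcont ?_⟩
  have h1 := h 1 one_pos
  have e : ∀ x : ℝ, x ^ ((2 : ℝ) + 1) = x ^ 3 := fun x => by
    rw [← Real.rpow_natCast]; norm_num
  simpa only [e] using h1
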